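/- **Conventions.** A partial application on a set $A$ is a partial function $A\times A\rightharpoonup A$, $(a,b)\mapsto ab$, associated to the left; a compound term is defined only if all its subterms are, and $t\simeq s$ means that $t$ is defined iff $s$ is, with equal values. $A$ is a *pca* if there are $K,S\in A$ with, for all $a,b,c\in A$: $Kab=a$; $Sab$ is defined; $Sabc\simeq ac(bc)$. $A$ is a *weak pca* if there are $K,S\in A$ with: $Kab=a$; $Sab$ is defined; $Sabc=ac(bc)$ whenever $ac(bc)$ is defined. Every pca is a weak pca. $A$ is *total* if $ab$ is always defined. An *applicative morphism* $\gamma:A\to B$ is a function from $A$ to the set of nonempty subsets of $B$ for which there is $r\in B$ such that, whenever $aa'$ is defined, $b\in\gamma(a)$ and $b'\in\gamma(a')$, then $rbb'$ is defined and lies in $\gamma(aa')$. Composition is $(\delta\gamma)(a)=\bigcup_{b\in\gamma(a)}\delta(b)$, the identity is $a\mapsto\{a\}$. $A\cong B$ means that there are applicative morphisms $\gamma:A\to B$, $\delta:B\to A$ with $\delta\gamma$ and $\gamma\delta$ equal to the identities. A partial function $f:A\rightharpoonup A$ is *representable in $A$* if there is $r\in A$ with $ra=f(a)$ for all $a\in\operatorname{dom}f$.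 **Definition of $A[f]$.** Let $A$ be a weak pca with a choice of $K,S$, and $f:A\rightharpoonup A$ a partial function. Put $I=SKK$, $\top=K$, $\bot=KI$, $p(a,b)=S(SI(Ka))(Kb)$ (so that $p(a,b)\top=a$, $p(a,b)\bot=b$), $\overline 0=I$, $\overline{n+1}=p(\bot,\overline n)$, and code a finite sequence by $[u_0,\dots,u_{n-1}]=p(\overline n,\,p(u_0,p(u_1,\dots p(u_{n-1},I)\dots)))$. An *$f$-dialogue* between $a$ and $b$ is a finite sequence $u_0,\dots,u_{n-1}$ in $A$ such that for every $i<n$ there is $v_i\in A$ with $a\cdot[b,u_0,\dots,u_{i-1}]=p(\bot,v_i)$ and $f(v_i)=u_i$. $A[f]$ is the set $A$ with the application $\cdot^f$ for which $a\cdot^f b$ is defined with value $c$ iff there is an $f$-dialogue $u_0,\dots,u_{n-1}$ between $a$ and $b$ with $a\cdot[b,u_0,\dots,u_{n-1}]=p(\top,c)$. $\mathcal K_1$ is $\mathbb N$ with $e\cdot n=$ the value at $n$ of the partial recursive function with index $e$; for a partial function $f:\mathbb N\rightharpoonup\mathbb N$, $\mathcal K_1^f$ is $\mathbb N$ with $e\cdot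 n=$ the value at $n$ of the function computed by the $e$-th program with oracle $f$ (an oracle call outside $\operatorname{dom}f$ diverges). **Statement.** Let $A$ be a weak pca (for example, a pca), let $f,g$ be partial functions $A\rightharpoonup A$, and let any choice of $K,S$ be made in each structure to which a partial function is adjoined. (0) $A[f]$ is a weak pca, and it is isomorphic to a pca. (i) If $f$ is representable in $A$, then $A\cong A[f]$. (ii) $A[f][g]\cong A[g][f]$. (iii) $\mathcal K_1$ is a pca, and for every partial function $f:\mathbb N\rightharpoonup\mathbb N$, $\mathcal K_1^f$ and $\mathcal K_1[f]$ are pcas and $\mathcal K_1^f\cong\mathcal K_1[f]$. (iv) If $A$ has more than one element, then $A[f]$ is not total. There exist a nontotal pca and a total pca that are isomorphic. -/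

import Mathlib

universe u v

namespace VO

/-! ### Partial applicative structures and pcas -/

/-- A partial binary application `A × A ⇀ A` on a set `A`. -/
abbrev PartialApp (A : Type u) := A → A → Part A

/-- Application of possibly undefined terms: `x y` is defined iff `x` and `y` are defined and the
value of `x` can be applied to the value of `y`. -/
def PartialApp.ap {A : Type u} (m : PartialApp A) (x y : Part A) : Part A :=
  x.bind fun a => y.bind fun b => m a b

/-- `(A, m)` is a partial combinatory algebra (pca): there are combinators `K` and `S` with
`K a b = a`, `S a b ↓` and `S a b c ≃ a c (b c)`. -/
def IsPCA {A : Type u} (m : PartialApp A) : Prop :=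
  ∃ K S : A,
    (∀ a b : A, m.ap (m K a) (Part.some b) = Part.some a) ∧
    (∀ a b : A, (m.ap (m S a) (Part.some b)).Dom) ∧
    (∀ a b c : A, m.ap (m.ap (m S a) (Part.some b)) (Part.some c) = m.ap (m a c) (m b c))

/-- A choice of combinators `K` and `S` for the application `m`, with `K a b = a`, `S a b ↓`, and
`S a b c = a c (b c)` whenever `a c (b c) ↓` (where `a c (b c)` is undefined, nothing is required of
`S a b c`). -/
structure Combinators {A : Type u} (m : PartialApp A) where
  K : A
  S : A
  K_spec : ∀ a b : A, m.ap (m K a) (Part.some b) = Part.some a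
  S_dom : ∀ a b : A, (m.ap (m S a) (Part.some b)).Dom
  S_spec : ∀ a b c x : A, x ∈ m.ap (m a c) (m b c) →
    x ∈ m.ap (m.ap (m S a) (Part.some b)) (Part.some c)

/-- `(A, m)` is a weak pca: combinators in the sense of `Combinators` exist. -/
def IsWeakPCA {A : Type u} (m : PartialApp A) : Prop := Nonempty (Combinators m)

theorem IsPCA.isWeakPCA {A : Type u} {m : PartialApp A} (h : IsPCA m) : IsWeakPCA m := by
  obtain ⟨K, S, hK, hd, hS⟩ := h
  exact ⟨⟨K, S, hK, hd, fun a b c x hx => by rw [hS]; exact hx⟩⟩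

/-- The application is everywhere defined. -/
def IsTotal {A : Type u} (m : PartialApp A) : Prop := ∀ a b : A, (m a b).Dom

/-! ### Applicative morphisms and isomorphism of pcas -/

/-- An applicative morphism `(A, m) → (B, n)`: a total relation, given as a function from `A` to
the nonempty subsets of `B`, that has a realizer `r`. -/
structure ApplicativeMorphism {A : Type u} {B : Type v} (m : PartialApp A) (n : PartialApp B) where
  rel : A → Set B
  nonempty : ∀ a, (rel a).Nonempty
  realizable : ∃ r : B, ∀ a a' x : A, x ∈ m a a' → ∀ b ∈ rel a, ∀ b' ∈ rel a',
    ∃ y ∈ n.ap (n r b) (Part.some b'), y ∈ rel x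

/-- The composite `δγ`, sending `a` to the union of the `δ b` for `b ∈ γ a`. -/
def relComp {A : Type*} {B : Type*} {C : Type*} (δ : B → Set C) (γ : A → Set B) : A → Set C :=
  fun a => ⋃ b ∈ γ a, δ b

/-- The identity `a ↦ {a}`. -/
def relId (A : Type u) : A → Set A := fun a => {a}

/-- Isomorphism in the category of pcas and applicative morphisms: both composites are equal to the
identities. -/
def Isomorphic {A : Type u} {B : Type v} (m : PartialApp A) (n : PartialApp B) : Prop :=
  ∃ (γ : ApplicativeMorphism m n) (δ : ApplicativeMorphism n m),
    relComp δ.rel γ.rel = relId A ∧ relComp γ.rel δ.rel = relId B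

/-- The partial function `f` on `A` is representable with respect to `γ : A → 𝒫*(B)`. -/
def RepresentableWrt {A : Type u} {B : Type v} (n : PartialApp B) (γ : A → Set B)
    (f : A →. A) : Prop :=
  ∃ r : B, ∀ a x : A, x ∈ f a → ∀ b ∈ γ a, ∃ y ∈ n r b, y ∈ γ x

/-- `f` is representable in `(A, m)`. -/
def Representable {A : Type u} (m : PartialApp A) (f : A →. A) : Prop :=
  RepresentableWrt m (relId A) f

/-! ### Booleans, pairing and coding of finite sequences -/

namespace Combinators

variable {A : Type u} {m : PartialApp A} (c : Combinators m)

theorem K_dom (a : A) : (m c.K a).Dom := by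
  have h : (m.ap (m c.K a) (Part.some a)).Dom := by rw [c.K_spec]; trivial
  exact h.1

/-- The element `K a`. -/
def k (a : A) : A := (m c.K a).get (c.K_dom a)

/-- The element `S a b`. -/
def s (a b : A) : A := (m.ap (m c.S a) (Part.some b)).get (c.S_dom a b)

/-- The identity combinator `S K K`. -/
def I : A := c.s c.K c.K

/-- The Boolean `⊤ = K`, so `⊤ a b = a`. -/
def tt : A := c.K

/-- The Boolean `⊥ = K I`, so `⊥ a b = b`. -/
def ff : A := c.k c.I

/-- The pair `p a b = Λ* z. z a b`, that is, the element `S (S I (K a)) (K b)`. -/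
def pair (a b : A) : A := c.s (c.s c.I (c.k a)) (c.k b)

/-- Numerals: `0` is `I`, and `n + 1` is the pair of `⊥` and `n`. -/
def num : ℕ → A
  | 0 => c.I
  | n + 1 => c.pair c.ff (num n)

/-- Iterated pairs `p u₀ (p u₁ (… I))`. -/
def tuple : List A → A
  | [] => c.I
  | a :: l => c.pair a (tuple l)

/-- The code `[u₀, …, uₙ₋₁]` of a finite sequence: the pair of its length and its tuple. -/
def code (l : List A) : A := c.pair (c.num l.length) (c.tuple l)

theorem K_app (a : A) : m c.K a = Part.some (c.k a) := (Part.some_get (c.K_dom a)).symm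

theorem k_app (a b : A) : m (c.k a) b = Part.some a := by
  have h := c.K_spec a b
  rw [c.K_app] at h
  simpa [PartialApp.ap] using h

theorem S_app (a b : A) : m.ap (m c.S a) (Part.some b) = Part.some (c.s a b) :=
  (Part.some_get (c.S_dom a b)).symm

theorem s_app {a b z x : A} (h : x ∈ m.ap (m a z) (m b z)) : m (c.s a b) z = Part.some x := by
  have h' := c.S_spec a b z x h
  rw [c.S_app] at h'
  exact Part.eq_some_iff.2 (by simpa [PartialApp.ap] using h')

theorem I_app (a : A) : m c.I a = Part.some a :=
  c.s_app (by rw [c.K_app]; simp [PartialApp.ap, c.k_app])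

theorem pair_app {a b z x : A} (h : x ∈ m.ap (m z a) (Part.some b)) :
    m (c.pair a b) z = Part.some x := by
  obtain ⟨y, hy, hx⟩ := Part.mem_bind_iff.1 h
  have h1 : m (c.s c.I (c.k a)) z = Part.some y :=
    c.s_app (by simpa [PartialApp.ap, c.I_app, c.k_app] using hy)
  exact c.s_app (by rw [h1, c.k_app]; simpa [PartialApp.ap] using hx)

theorem pair_tt (a b : A) : m (c.pair a b) c.tt = Part.some a :=
  c.pair_app (by rw [tt, c.K_spec]; exact Part.mem_some a)

theorem pair_ff (a b : A) : m (c.pair a b) c.ff = Part.some b :=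
  c.pair_app (by simp [ff, c.k_app, PartialApp.ap, c.I_app])

theorem pair_inj {a b a' b' : A} (h : c.pair a b = c.pair a' b') : a = a' ∧ b = b' := by
  constructor
  · have h1 := c.pair_tt a b
    rw [h, c.pair_tt] at h1
    exact (Part.some_inj.1 h1).symm
  · have h1 := c.pair_ff a b
    rw [h, c.pair_ff] at h1
    exact (Part.some_inj.1 h1).symm

theorem eq_of_tt_eq_ff (h : c.tt = c.ff) (a b : A) : a = b := by
  have h1 := c.pair_tt a b
  rw [h, c.pair_ff] at h1
  exact (Part.some_inj.1 h1).symm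

/-! ### The structure `A[f]` -/

/-- `u` is (the sequence coded by) an `f`-dialogue between `a` and `b`: for all `i < n` there is `v`
such that `a · ([b] * [u₀, …, uᵢ₋₁]) = p ⊥ v` and `f v = uᵢ`. -/
def IsDialogue (f : A →. A) (a b : A) (u : List A) : Prop :=
  ∀ (i : ℕ) (hi : i < u.length), ∃ v : A,
    m a (c.code (b :: u.take i)) = Part.some (c.pair c.ff v) ∧ u[i] ∈ f v

/-- Some `f`-dialogue `u` between `a` and `b` satisfies `a · ([b] * u) = p ⊤ x`. -/
def DialogueValue (f : A →. A) (a b x : A) : Prop :=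
  ∃ u : List A, c.IsDialogue f a b u ∧ m a (c.code (b :: u)) = Part.some (c.pair c.tt x)

theorem dialogue_prefix {f : A →. A} {a b : A} {u w : List A} (hu : c.IsDialogue f a b u)
    (hw : c.IsDialogue f a b w) (i : ℕ) (hiu : i ≤ u.length) (hiw : i ≤ w.length) :
    u.take i = w.take i := by
  induction i with
  | zero => simp
  | succ i ih =>
    have ih := ih (by omega) (by omega)
    obtain ⟨v, hv, hv'⟩ := hu i (by omega)
    obtain ⟨v', hw1, hw2⟩ := hw i (by omega)
    rw [ih, hw1] at hv
    have := (c.pair_inj (Part.some_inj.1 hv)).2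
    subst this
    rw [List.take_succ_eq_append_getElem (by omega), List.take_succ_eq_append_getElem (by omega),
      ih, Part.mem_unique hv' hw2]

theorem dialogueValue_unique {f : A →. A} {a b x y : A} (hx : c.DialogueValue f a b x)
    (hy : c.DialogueValue f a b y) : x = y := by
  obtain ⟨u, hu, hux⟩ := hx
  obtain ⟨w, hw, hwy⟩ := hy
  rcases lt_trichotomy u.length w.length with h | h | h
  · have hp := c.dialogue_prefix hu hw u.length le_rfl h.le
    obtain ⟨v, hv, -⟩ := hw _ h
    rw [← hp, List.take_length, hux] at hv
    exact c.eq_of_tt_eq_ff (c.pair_inj (Part.some_inj.1 hv)).1 _ _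
  · have hp := c.dialogue_prefix hu hw u.length le_rfl h.le
    rw [List.take_length, h, List.take_length] at hp
    subst hp
    rw [hux] at hwy
    exact (c.pair_inj (Part.some_inj.1 hwy)).2
  · have hp := c.dialogue_prefix hu hw w.length h.le le_rfl
    obtain ⟨v, hv, -⟩ := hu _ h
    rw [hp, List.take_length, hwy] at hv
    exact c.eq_of_tt_eq_ff (c.pair_inj (Part.some_inj.1 hv)).1 _ _

/-- The application `·ᶠ` of `A[f]`, whose underlying set is `A`. -/
noncomputable def adjoin (f : A →. A) : PartialApp A := fun a b =>
  ⟨∃ x, c.DialogueValue f a b x, fun h => h.choose⟩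

theorem mem_adjoin {f : A →. A} {a b x : A} : x ∈ c.adjoin f a b ↔ c.DialogueValue f a b x := by
  constructor
  · rintro ⟨h, rfl⟩
    exact h.choose_spec
  · intro hx
    exact ⟨⟨x, hx⟩, c.dialogueValue_unique (Exists.choose_spec (⟨x, hx⟩ : ∃ x, _)) hx⟩

end Combinators

/-! ### Kleene's first model and its relativization to an oracle -/

/-- Kleene's pca `𝒦₁`: `e · n` is the value at `n` of the partial recursive function with index
`e`. -/
def kleene : PartialApp ℕ := fun e n => (Nat.Partrec.Code.ofNatCode e).eval n

/-- Programs with an oracle: the program constructors of `Nat.Partrec.Code`, and an oracle call. -/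
inductive OracleCode : Type
  | zero : OracleCode
  | succ : OracleCode
  | left : OracleCode
  | right : OracleCode
  | oracle : OracleCode
  | pair : OracleCode → OracleCode → OracleCode
  | comp : OracleCode → OracleCode → OracleCode
  | prec : OracleCode → OracleCode → OracleCode
  | rfind' : OracleCode → OracleCode

namespace OracleCode

/-- The partial function computed by a program with oracle `f`. A call of the oracle outside the
domain of `f` makes the computation diverge. -/
def eval (f : ℕ →. ℕ) : OracleCode → ℕ →. ℕ
  | zero => fun _ => Part.some 0
  | succ => fun n => Part.some (n + 1)
  | left => fun n => Part.some n.unpair.1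
  | right => fun n => Part.some n.unpair.2
  | oracle => f
  | pair cf cg => fun n => Nat.pair <$> eval f cf n <*> eval f cg n
  | comp cf cg => fun n => eval f cg n >>= eval f cf
  | prec cf cg =>
    Nat.unpaired fun a n =>
      n.rec (eval f cf a) fun y IH => do
        let i ← IH
        eval f cg (Nat.pair a (Nat.pair y i))
  | rfind' cf =>
    Nat.unpaired fun a m =>
      (Nat.rfind fun n => (fun m => m = 0) <$> eval f cf (Nat.pair a (n + m))).map (· + m)

/-- The Gödel number of a program. -/
def encode : OracleCode → ℕ
  | zero => 0
  | succ => 1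
  | left => 2
  | right => 3
  | oracle => 4
  | pair cf cg => 4 * Nat.pair (encode cf) (encode cg) + 5
  | comp cf cg => 4 * Nat.pair (encode cf) (encode cg) + 6
  | prec cf cg => 4 * Nat.pair (encode cf) (encode cg) + 7
  | rfind' cf => 4 * encode cf + 8

/-- The program with a given Gödel number. -/
def decode : ℕ → OracleCode
  | 0 => zero
  | 1 => succ
  | 2 => left
  | 3 => right
  | 4 => oracle
  | n + 5 =>
    have h1 : (n / 4).unpair.1 < n + 5 := by
      have := (n / 4).unpair_left_le; omega
    have h2 : (n / 4).unpair.2 < n + 5 := by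
      have := (n / 4).unpair_right_le; omega
    have h3 : n / 4 < n + 5 := by omega
    match n % 4 with
    | 0 => pair (decode (n / 4).unpair.1) (decode (n / 4).unpair.2)
    | 1 => comp (decode (n / 4).unpair.1) (decode (n / 4).unpair.2)
    | 2 => prec (decode (n / 4).unpair.1) (decode (n / 4).unpair.2)
    | _ => rfind' (decode (n / 4))

theorem decode_encode (p : OracleCode) : decode (encode p) = p := by
  induction p with
  | zero | succ | left | right | oracle => simp [encode, decode]
  | pair p q hp hq =>
    simp [encode, decode, hp, hq]
  | comp p q hp hq =>
    rw [encode, show 4 * Nat.pair p.encode q.encode + 6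
      = (4 * Nat.pair p.encode q.encode + 1) + 5 from rfl, decode]
    have e1 : (4 * Nat.pair p.encode q.encode + 1) / 4 = Nat.pair p.encode q.encode := by omega
    have e2 : (4 * Nat.pair p.encode q.encode + 1) % 4 = 1 := by omega
    simp [e1, e2, hp, hq]
  | prec p q hp hq =>
    rw [encode, show 4 * Nat.pair p.encode q.encode + 7
      = (4 * Nat.pair p.encode q.encode + 2) + 5 from rfl, decode]
    have e1 : (4 * Nat.pair p.encode q.encode + 2) / 4 = Nat.pair p.encode q.encode := by omega
    have e2 : (4 * Nat.pair p.encode q.encode + 2) % 4 = 2 := by omega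
    simp [e1, e2, hp, hq]
  | rfind' p hp =>
    rw [encode, show 4 * p.encode + 8 = (4 * p.encode + 3) + 5 from rfl, decode]
    have e1 : (4 * p.encode + 3) / 4 = p.encode := by omega
    have e2 : (4 * p.encode + 3) % 4 = 3 := by omega
    simp [e1, e2, hp]

end OracleCode

/-- Kleene's pca `𝒦₁ᶠ` with an oracle for the partial function `f`: `e · n` is the value at `n` of
the function computed with oracle `f` by the program with Gödel number `e`. -/
def kleeneOracle (f : ℕ →. ℕ) : PartialApp ℕ := fun e n => (OracleCode.decode e).eval f n

end VO

/-! Every isomorphism in the statement is carried by the identity on elements, so each amounts to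
two relations `Le m n`: one element of `n` simulates the application of `m` inside `n`. For this
relation `A[f]` has a universal property: `A ≤ A[f]` (`le_adjoin`), `f` is representable in `A[f]`
(`representable_adjoin`), and `A[f] ≤ n` whenever `A ≤ n` and `f` is representable in `n`
(`adjoin_le`), because `n` can conduct the dialogue itself and answer each question with its
representer of `f`. Parts (i) and (ii) are formal consequences. So is `𝒦₁ᶠ ≅ 𝒦₁[f]`, once `𝒦₁ᶠ` is
known to have the same property (`kleeneOracle_le`).

Combinators in `A[f]` come from composing dialogues. The element `bindElt a k` replays `a` on longer
and longer prefixes of the answers received, forwards its questions, and hands the remaining answers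
to `k x` once `a` has returned `x`. Two such compositions, for `a z` and `b z`, followed by the
dialogue of the first value at the second, give `S` (`exists_adjoin_combinators`). In a weak pca a
composite may converge without its parts doing so; only one direction of the law for `S` results. If
`S` is strict and a guard diverges on everything that is neither a question nor a result, a dialogue
of the composite can be cut back into its parts (`of_adjoin_bind`), and `A[f]` is a pca. `𝒦₁` has
both.

A weak pca becomes a pca by treating `S a b` as a formal pair whose application is, by inductive
definition, that of `a z` to `b z` (`tagged_isPCA`); an evaluator for these pairs lives in the
original structure. The new structure is not total, since an element with neither tag cannot be
applied. Starting from the total graph model, this gives the example in (iv). For `A[f]` itself, a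
constant program whose output has neither tag is nowhere defined.

The oracle programs are run by a stack machine all of whose steps are primitive recursive except the
oracle call. It yields a universal program for `𝒦₁ᶠ`, and it can be run in any `n ≥ 𝒦₁` that
represents `f`. -/

namespace VO

/-! ### Combinatory completeness -/

/-- Applicative terms with constants from `A` and variables named by natural numbers. -/
inductive Term (A : Type u) : Type u
  | var : ℕ → Term A
  | const : A → Term A
  | app : Term A → Term A → Term A

infixl:70 " ⬝ " => Term.app

/-- Rebind the variable `o` (if any) to `a`. -/
def upd {A : Type u} (env : ℕ → A) (o : Option ℕ) (a : A) : ℕ → A :=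
  fun i => if some i = o then a else env i

@[simp]
theorem upd_none {A : Type u} (env : ℕ → A) (a : A) : upd env none a = env := by
  funext i; simp [upd]

@[simp]
theorem upd_some {A : Type u} (env : ℕ → A) (x : ℕ) (a : A) (i : ℕ) :
    upd env (some x) a i = if i = x then a else env i := by
  simp [upd]

/-- The value of a term under an assignment of the variables. -/
def Term.eval {A : Type u} (m : PartialApp A) (env : ℕ → A) : Term A → Part A
  | .var i => Part.some (env i)
  | .const a => Part.some a
  | .app t s => m.ap (t.eval m env) (s.eval m env)

theorem PartialApp.ap_some_some {A : Type u} (m : PartialApp A) (a b : A) :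
    m.ap (Part.some a) (Part.some b) = m a b := by
  simp [PartialApp.ap]

@[simp]
theorem PartialApp.ap_none_left {A : Type u} (m : PartialApp A) (q : Part A) :
    m.ap Part.none q = Part.none := by
  simp [PartialApp.ap]

@[simp]
theorem PartialApp.ap_none_right {A : Type u} (m : PartialApp A) (p : Part A) :
    m.ap p Part.none = Part.none := by
  simp [PartialApp.ap, Part.eq_none_iff]

theorem PartialApp.mem_ap {A : Type u} {m : PartialApp A} {p q : Part A} {x : A} :
    x ∈ m.ap p q ↔ ∃ a ∈ p, ∃ b ∈ q, x ∈ m a b := by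
  simp [PartialApp.ap]

theorem PartialApp.ap_mono {A : Type u} (m : PartialApp A) {p p' q q' : Part A} (hp : p ≤ p')
    (hq : q ≤ q') : m.ap p q ≤ m.ap p' q' := by
  intro x hx
  obtain ⟨a, ha, b, hb, hx⟩ := PartialApp.mem_ap.1 hx
  exact PartialApp.mem_ap.2 ⟨a, hp a ha, b, hq b hb, hx⟩

section Eval

variable {A : Type u} (m : PartialApp A) (env : ℕ → A)

@[simp]
theorem Term.eval_var (i : ℕ) : (Term.var i).eval m env = Part.some (env i) := rfl

@[simp]
theorem Term.eval_const (a : A) : (Term.const a).eval m env = Part.some a := rfl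

@[simp]
theorem Term.eval_app (t s : Term A) :
    (t ⬝ s).eval m env = m.ap (t.eval m env) (s.eval m env) := rfl

end Eval

namespace Combinators

variable {A : Type u} {m : PartialApp A} (d : Combinators m)

/-- The equation `S a b c ≃ a c (b c)` holds in the strict sense. -/
def Strict : Prop := ∀ a b z : A, m (d.s a b) z = m.ap (m a z) (m b z)

/-- `q` extends `p`, and agrees with it when the combinators are strict. -/
def Approx (p q : Part A) : Prop := p ≤ q ∧ (d.Strict → p = q)

variable {d}

theorem Approx.of_eq {p q : Part A} (h : p = q) : d.Approx p q := ⟨h.le, fun _ => h⟩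

theorem Approx.refl (p : Part A) : d.Approx p p := .of_eq rfl

theorem Approx.trans {p q r : Part A} (h : d.Approx p q) (h' : d.Approx q r) : d.Approx p r :=
  ⟨h.1.trans h'.1, fun s => (h.2 s).trans (h'.2 s)⟩

theorem Approx.ap {p p' q q' : Part A} (h : d.Approx p p') (h' : d.Approx q q') :
    d.Approx (m.ap p q) (m.ap p' q') :=
  ⟨m.ap_mono h.1 h'.1, fun s => by rw [h.2 s, h'.2 s]⟩

theorem Approx.bind {p q : Part A} {g g' : A → Part A} (h : d.Approx p q)
    (h' : ∀ a, d.Approx (g a) (g' a)) : d.Approx (p.bind g) (q.bind g') := by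
  refine ⟨fun x hx => ?_, fun s => ?_⟩
  · obtain ⟨a, ha, hx⟩ := Part.mem_bind_iff.1 hx
    exact Part.mem_bind_iff.2 ⟨a, h.1 a ha, (h' a).1 x hx⟩
  · rw [h.2 s]
    congr 1
    funext a
    exact (h' a).2 s

theorem Approx.eq_some {v : A} {q : Part A} (h : d.Approx (Part.some v) q) : q = Part.some v :=
  Part.eq_some_iff.2 (h.1 v (Part.mem_some v))

theorem Approx.of_eq_some {v : A} {p q : Part A} (h : d.Approx p q) (hp : p = Part.some v) :
    q = Part.some v :=
  (hp ▸ h).eq_some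

variable (d)

-- `abs` distributes `S` over every application, even one in which the variable does not occur. No
-- application of the body is performed before an argument arrives, so abstractions always have a
-- value and can serve as lazy branches.
@[simp]
theorem ap_K (a : A) : m.ap (Part.some d.K) (Part.some a) = Part.some (d.k a) := by
  rw [m.ap_some_some, d.K_app a]

@[simp]
theorem ap_k (a b : A) : m.ap (Part.some (d.k a)) (Part.some b) = Part.some a := by
  rw [m.ap_some_some, d.k_app a b]

@[simp]
theorem ap_S (a b : A) :
    m.ap (m.ap (Part.some d.S) (Part.some a)) (Part.some b) = Part.some (d.s a b) := by
  rw [m.ap_some_some, d.S_app a b]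

@[simp]
theorem ap_I (a : A) : m.ap (Part.some d.I) (Part.some a) = Part.some a := by
  rw [m.ap_some_some, d.I_app a]

theorem approx_s (a b z : A) : d.Approx (m.ap (m a z) (m b z)) (m (d.s a b) z) :=
  ⟨fun x hx => by rw [d.s_app hx]; exact Part.mem_some x, fun h => (h a b z).symm⟩

/-- Bracket abstraction: `abs (some x) t` is `λ x. t`, and `abs none t` is `λ _. t`. -/
def abs (o : Option ℕ) : Term A → Term A
  | .var i => if some i = o then .const d.I else .const d.K ⬝ .var i
  | .const a => .const d.K ⬝ .const a
  | .app t s => .const d.S ⬝ abs o t ⬝ abs o s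

/-- The value of `abs o t`. -/
def clo (env : ℕ → A) (o : Option ℕ) : Term A → A
  | .var i => if some i = o then d.I else d.k (env i)
  | .const a => d.k a
  | .app t s => d.s (clo env o t) (clo env o s)

/-- `λ x. t`. -/
abbrev lam (x : ℕ) (t : Term A) : Term A := d.abs (some x) t

@[simp]
theorem eval_abs (env : ℕ → A) (o : Option ℕ) (t : Term A) :
    (d.abs o t).eval m env = Part.some (d.clo env o t) := by
  induction t with
  | var i => by_cases h : some i = o <;> simp [abs, clo, h]
  | const a => simp [abs, clo]
  | app t s iht ihs => simp [abs, clo, iht, ihs]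

/-- In a weak pca β-reduction only preserves convergence, while for strict combinators it is an
equality. `Approx` records both, so that one computation serves the weak case and the case of `𝒦₁`.
-/
theorem approx_clo (env : ℕ → A) (o : Option ℕ) (t : Term A) (a : A) :
    d.Approx (t.eval m (upd env o a)) (m.ap (Part.some (d.clo env o t)) (Part.some a)) := by
  rw [m.ap_some_some]
  induction t with
  | var i => by_cases h : some i = o <;> exact .of_eq (by simp [upd, clo, h, ← m.ap_some_some])
  | const a => exact .of_eq (by simp [clo, ← m.ap_some_some])
  | app t s iht ihs => exact (iht.ap ihs).trans (d.approx_s _ _ _)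

theorem clo_app_of {env : ℕ → A} {o : Option ℕ} {t : Term A} {a v : A}
    (h : t.eval m (upd env o a) = Part.some v) :
    m.ap (Part.some (d.clo env o t)) (Part.some a) = Part.some v :=
  (d.approx_clo env o t a).of_eq_some h

@[simp]
theorem clo_abs_app (env : ℕ → A) (o o' : Option ℕ) (t : Term A) (a : A) :
    m.ap (Part.some (d.clo env o (d.abs o' t))) (Part.some a) =
      Part.some (d.clo (upd env o a) o' t) :=
  d.clo_app_of (d.eval_abs _ _ _)

/-- `let x := s; t`. -/
def letIn (x : ℕ) (s t : Term A) : Term A := d.lam x t ⬝ s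

theorem approx_letIn {env : ℕ → A} {x : ℕ} {s t : Term A} {a : A}
    (h : s.eval m env = Part.some a) :
    d.Approx (t.eval m (upd env (some x) a)) ((d.letIn x s t).eval m env) := by
  simpa [letIn, h] using d.approx_clo env (some x) t a

/-- `if b then t else s` with lazy branches; `b` is a Boolean. -/
def ite (b t s : Term A) : Term A := b ⬝ d.abs none t ⬝ d.abs none s ⬝ .const d.K

variable {d} in
theorem approx_ite_tt (c : Combinators m) {env : ℕ → A} {b t s : Term A}
    (h : b.eval m env = Part.some c.tt) : d.Approx (t.eval m env) ((d.ite b t s).eval m env) := by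
  have := d.approx_clo env none t d.K
  simpa [ite, h, tt] using this

variable {d} in
theorem approx_ite_ff (c : Combinators m) {env : ℕ → A} {b t s : Term A}
    (h : b.eval m env = Part.some c.ff) : d.Approx (s.eval m env) ((d.ite b t s).eval m env) := by
  have := d.approx_clo env none s d.K
  simpa [ite, h, ff] using this

/-! Data terms. -/

/-- The pair of two terms. -/
def pairT (t s : Term A) : Term A :=
  .const d.S ⬝ (.const d.S ⬝ .const d.I ⬝ (.const d.K ⬝ t)) ⬝ (.const d.K ⬝ s)

/-- The first component of a pair. -/
def fstT (t : Term A) : Term A := t ⬝ .const d.tt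

/-- The second component of a pair. -/
def sndT (t : Term A) : Term A := t ⬝ .const d.ff

@[simp]
theorem pair_ap_tt (a b : A) : m.ap (Part.some (d.pair a b)) (Part.some d.tt) = Part.some a := by
  rw [m.ap_some_some, d.pair_tt a b]

@[simp]
theorem pair_ap_ff (a b : A) : m.ap (Part.some (d.pair a b)) (Part.some d.ff) = Part.some b := by
  rw [m.ap_some_some, d.pair_ff a b]

@[simp]
theorem eval_pairT (env : ℕ → A) (t s : Term A) : (d.pairT t s).eval m env =
    (t.eval m env).bind fun a => (s.eval m env).bind fun b => Part.some (d.pair a b) := by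
  rcases Part.eq_none_or_eq_some (t.eval m env) with ht | ⟨a, ht⟩
  · simp [pairT, ht]
  · rcases Part.eq_none_or_eq_some (s.eval m env) with hs | ⟨b, hs⟩ <;> simp [pairT, ht, hs, pair]

@[simp]
theorem eval_fstT (env : ℕ → A) (t : Term A) :
    (d.fstT t).eval m env = m.ap (t.eval m env) (Part.some d.tt) := rfl

@[simp]
theorem eval_sndT (env : ℕ → A) (t : Term A) :
    (d.sndT t).eval m env = m.ap (t.eval m env) (Part.some d.ff) := rfl

@[simp]
theorem num_zero : d.num 0 = d.I := rfl

@[simp]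
theorem num_succ (n : ℕ) : d.num (n + 1) = d.pair d.ff (d.num n) := rfl

/-- An assignment of the variables that is used where no variable is free. -/
def env₀ : ℕ → A := fun _ => d.K

/-! ### Distinctness of `⊤`, `⊥` and `I` in a nontrivial structure -/

theorem tt_ne_ff [Nontrivial A] : d.tt ≠ d.ff := fun h => by
  obtain ⟨a, b, hab⟩ := exists_pair_ne A
  exact hab (d.eq_of_tt_eq_ff h a b)

/-- If `I = K`, then `K I = I I = I`, so that `a = I a = K I a = I` for every `a`. Thus `I` is a tag
different from `⊤`, which is what the proofs of nontotality need. -/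
theorem I_ne_tt [Nontrivial A] : d.I ≠ d.tt := fun h => by
  have h1 : d.k d.I = d.I := by
    have := d.ap_I d.I
    rw [h, tt, ap_K, Part.some_inj] at this
    rw [← tt, ← h] at this
    exact this
  obtain ⟨a, b, hab⟩ := exists_pair_ne A
  have h2 (a : A) : a = d.I := by
    have := d.ap_k d.I a
    rw [h1] at this
    simpa using this
  exact hab ((h2 a).trans (h2 b).symm)

theorem I_ne_ff [Nontrivial A] : d.I ≠ d.ff := fun h => by
  obtain ⟨a, b, hab⟩ := exists_pair_ne A
  have h2 (a : A) : a = d.I := by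
    have h3 := d.ap_I a
    rw [h, ff, ap_k] at h3
    exact (Part.some_inj.1 h3).symm
  exact hab ((h2 a).trans (h2 b).symm)

end Combinators

/-! ### Morphisms that are the identity on elements -/

/-- The identity function on `A` is an applicative morphism `(A, m) → (A, n)`. -/
def Le {A : Type u} (m n : PartialApp A) : Prop :=
  ∃ r : A, ∀ a b x : A, x ∈ m a b → x ∈ n.ap (n r a) (Part.some b)

/-- The morphism given by the identity function. -/
def Le.morphism {A : Type u} {m n : PartialApp A} (h : Le m n) : ApplicativeMorphism m n where
  rel := relId A
  nonempty a := ⟨a, rfl⟩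
  realizable := by
    obtain ⟨r, hr⟩ := h
    refine ⟨r, fun a a' x hx b hb b' hb' => ?_⟩
    cases hb
    cases hb'
    exact ⟨x, hr a a' x hx, rfl⟩

theorem Isomorphic.of_le {A : Type u} {m n : PartialApp A} (h : Le m n) (h' : Le n m) :
    Isomorphic m n := by
  refine ⟨h.morphism, h'.morphism, ?_, ?_⟩ <;>
  · funext a
    simp [relComp, Le.morphism, relId]

theorem ap_of_realizer {A : Type u} {m n : PartialApp A} {r : A}
    (hr : ∀ a b x : A, x ∈ m a b → x ∈ n.ap (n r a) (Part.some b)) {a b x : A}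
    (h : m.ap (Part.some a) (Part.some b) = Part.some x) :
    n.ap (n.ap (Part.some r) (Part.some a)) (Part.some b) = Part.some x := by
  rw [m.ap_some_some] at h
  rw [n.ap_some_some]
  exact Part.eq_some_iff.2 (hr a b x (Part.eq_some_iff.1 h))

/-- A curried application needs the realizer twice: the intermediate value is an element of the same
set and has to be applied through `r` again. -/
theorem ap_of_realizer₂ {A : Type u} {m n : PartialApp A} {r : A}
    (hr : ∀ a b x : A, x ∈ m a b → x ∈ n.ap (n r a) (Part.some b)) {a b b' x : A}
    (h : m.ap (m.ap (Part.some a) (Part.some b)) (Part.some b') = Part.some x) :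
    n.ap (n.ap (Part.some r) (n.ap (n.ap (Part.some r) (Part.some a)) (Part.some b)))
      (Part.some b') = Part.some x := by
  obtain ⟨y, hy, y', hy', hx⟩ := PartialApp.mem_ap.1 (Part.eq_some_iff.1 h)
  cases Part.mem_some_iff.1 hy'
  rw [ap_of_realizer hr (Part.eq_some_iff.2 hy)]
  exact ap_of_realizer hr ((m.ap_some_some _ _).trans (Part.eq_some_iff.2 hx))

theorem Le.trans {A : Type u} {m n o : PartialApp A} (d : Combinators o) (h : Le m n)
    (h' : Le n o) : Le m o := by
  obtain ⟨r, hr⟩ := h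
  obtain ⟨r', hr'⟩ := h'
  -- The value of `r a` in `n` is obtained in `o` as `r' r a`; the outer `r'` then simulates its
  -- application to `b`.
  refine ⟨d.clo d.env₀ (some 0) (.const r' ⬝ (.const r' ⬝ .const r ⬝ .var 0)),
    fun a b x hx => ?_⟩
  obtain ⟨y, hy, b', hb', hx⟩ := PartialApp.mem_ap.1 (hr a b x hx)
  cases Part.mem_some_iff.1 hb'
  rw [← o.ap_some_some]
  refine o.ap_mono (d.approx_clo _ _ _ _).1 le_rfl x ?_
  obtain ⟨z, hz, b'', hb'', hx⟩ := PartialApp.mem_ap.1 (hr' y b x hx)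
  cases Part.mem_some_iff.1 hb''
  refine PartialApp.mem_ap.2 ⟨z, ?_, _, Part.mem_some _, hx⟩
  have h1 : o.ap (o r' r) (Part.some a) = Part.some y := Part.eq_some_iff.2 (hr' r a y hy)
  simpa [h1, PartialApp.ap_some_some] using hz

theorem representable_iff {A : Type u} {m : PartialApp A} {f : A →. A} :
    Representable m f ↔ ∃ r : A, ∀ a x : A, x ∈ f a → x ∈ m r a := by
  constructor
  · rintro ⟨r, hr⟩
    refine ⟨r, fun a x hx => ?_⟩
    obtain ⟨y, hy, rfl⟩ := hr a x hx a rfl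
    exact hy
  · rintro ⟨r, hr⟩
    refine ⟨r, fun a x hx b hb => ?_⟩
    cases hb
    exact ⟨x, hr a x hx, rfl⟩

theorem Representable.of_le {A : Type u} {m n : PartialApp A} (d : Combinators n) (h : Le m n)
    {f : A →. A} (hf : Representable m f) : Representable n f := by
  obtain ⟨r, hr⟩ := h
  obtain ⟨e, he⟩ := representable_iff.1 hf
  refine representable_iff.2 ⟨d.clo d.env₀ (some 0) (.const r ⬝ .const e ⬝ .var 0),
    fun a x hx => ?_⟩
  rw [← n.ap_some_some]
  refine (d.approx_clo _ _ _ _).1 x ?_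
  simpa [PartialApp.ap_some_some] using hr e a x (he a x hx)

namespace Combinators

variable {A : Type u} {m : PartialApp A} (c : Combinators m)

/-! ### Operations on codes of finite sequences -/

/-- The first element of a coded sequence. -/
def headT (t : Term A) : Term A := c.fstT (c.sndT t)

/-- The coded sequence without its first element. -/
def tailT (t : Term A) : Term A := c.pairT (c.sndT (c.fstT t)) (c.sndT (c.sndT t))

/-- The coded sequence `t` with `s` put in front. -/
def consT (s t : Term A) : Term A :=
  c.pairT (c.pairT (.const c.ff) (c.fstT t)) (c.pairT s (c.sndT t))

/-- Whether a coded sequence is empty. -/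
def nilT (t : Term A) : Term A := c.fstT (c.fstT t)

theorem code_nil : c.code [] = c.pair c.I c.I := rfl

theorem code_cons (a : A) (l : List A) :
    c.code (a :: l) = c.pair (c.pair c.ff (c.num l.length)) (c.pair a (c.tuple l)) := rfl

variable {env : ℕ → A} {t s : Term A}

theorem eval_headT {a : A} {l : List A} (h : t.eval m env = Part.some (c.code (a :: l))) :
    (c.headT t).eval m env = Part.some a := by
  simp [headT, h, code_cons]

theorem eval_tailT {a : A} {l : List A} (h : t.eval m env = Part.some (c.code (a :: l))) :
    (c.tailT t).eval m env = Part.some (c.code l) := by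
  simp [tailT, h, code, tuple]

theorem eval_consT {a : A} {l : List A} (hs : s.eval m env = Part.some a)
    (h : t.eval m env = Part.some (c.code l)) :
    (c.consT s t).eval m env = Part.some (c.code (a :: l)) := by
  simp [consT, h, hs, code, tuple]

/-- The numeral `0` is `I`, and `I ⊤ = ⊤`; hence taking a first component tests a numeral for zero
although `0` is not a pair by construction. -/
theorem eval_nilT_nil (h : t.eval m env = Part.some (c.code [])) :
    (c.nilT t).eval m env = Part.some c.tt := by
  simp [nilT, h, code_nil]

theorem eval_nilT_cons {a : A} {l : List A} (h : t.eval m env = Part.some (c.code (a :: l))) :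
    (c.nilT t).eval m env = Part.some c.ff := by
  simp [nilT, h, code_cons]

theorem exists_single : ∃ r : A, ∀ a : A,
    m.ap (Part.some r) (Part.some a) = Part.some (c.code [a]) :=
  ⟨c.clo c.env₀ (some 0) (c.consT (.var 0) (.const (c.code []))), fun a =>
    c.clo_app_of (c.eval_consT (by simp) (by simp))⟩

/-- The recursion is driven by the length, because the end of a tuple cannot be recognized: the
entries are arbitrary, so a nonempty tuple may also give `⊤` when applied to `⊤`. -/
theorem exists_tuple_append : ∃ r : A, ∀ (l : List A) (a : A),
    m.ap (m.ap (m.ap (Part.some r) (Part.some (c.num l.length))) (Part.some (c.tuple l)))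
      (Part.some a) = Part.some (c.tuple (l ++ [a])) := by
  let body : Term A := c.ite (c.fstT (.var 1)) (c.pairT (.var 3) (.const c.I))
    (c.pairT (c.fstT (.var 2))
      (.var 0 ⬝ .var 0 ⬝ c.sndT (.var 1) ⬝ c.sndT (.var 2) ⬝ .var 3))
  -- Recursion by self-application: with variable 0 bound to `W`, the subterm `.var 0 ⬝ .var 0` is
  -- the recursive call. The value of `W W` is itself a closure, hence defined, and it is the
  -- witness.
  let W : A := c.clo c.env₀ (some 0) (c.lam 1 (c.lam 2 (c.lam 3 body)))
  refine ⟨c.clo (upd c.env₀ (some 0) W) (some 1) (c.lam 2 (c.lam 3 body)), fun l a => ?_⟩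
  induction l with
  | nil =>
    simp only [clo_abs_app]
    refine c.clo_app_of ((approx_ite_tt c ?_).of_eq_some ?_)
    · simp
    · simp [tuple]
  | cons b l ih =>
    simp only [clo_abs_app] at ih ⊢
    refine c.clo_app_of ((approx_ite_ff c ?_).of_eq_some ?_)
    · simp
    · simp [tuple, W, ih]

theorem exists_snoc : ∃ r : A, ∀ (l : List A) (a : A),
    m.ap (m.ap (Part.some r) (Part.some (c.code l))) (Part.some a) =
      Part.some (c.code (l ++ [a])) := by
  obtain ⟨r, hr⟩ := c.exists_tuple_append
  refine ⟨c.clo c.env₀ (some 0) (c.lam 1 (c.pairT (c.pairT (.const c.ff) (c.fstT (.var 0)))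
    (.const r ⬝ c.fstT (.var 0) ⬝ c.sndT (.var 0) ⬝ .var 1))), fun l a => ?_⟩
  rw [clo_abs_app]
  refine c.clo_app_of ?_
  simp [code, hr]

end Combinators

namespace Combinators

variable {A : Type u} {m : PartialApp A} (c d : Combinators m)

/-! ### Sequential composition of dialogues -/

theorem mem_adjoin_of_eq {f : A →. A} {a b x : A}
    (h : m.ap (Part.some a) (Part.some (c.code [b])) = Part.some (c.pair c.tt x)) :
    x ∈ c.adjoin f a b :=
  c.mem_adjoin.2 ⟨[], fun i hi => absurd hi (by simp), by rwa [m.ap_some_some] at h⟩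

/-- `q` is the identity on the pairs that occur as results of dialogue steps. -/
def IsGuard (q : A) : Prop :=
  (∀ x, m.ap (Part.some q) (Part.some (c.pair c.tt x)) = Part.some (c.pair c.tt x)) ∧
  ∀ x, m.ap (Part.some q) (Part.some (c.pair c.ff x)) = Part.some (c.pair c.ff x)

/-- `q` is undefined outside the pairs that occur as results of dialogue steps. -/
def IsStrictGuard (q : A) : Prop :=
  ∀ w, (m q w).Dom → ∃ x, w = c.pair c.tt x ∨ w = c.pair c.ff x

theorem isGuard_I : c.IsGuard c.I := ⟨fun _ => c.ap_I _, fun _ => c.ap_I _⟩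

variable (q e : A)

/-- One step of the execution of the dialogue of `var 1`, where `var 4` is the list consumed so far
and `var 5` is the remaining list; the value is passed to `var 2`. -/
def runBody : Term A :=
  d.letIn 6 (.const q ⬝ (.var 1 ⬝ .var 4)) <|
    d.ite (c.fstT (.var 6)) (.var 2 ⬝ c.sndT (.var 6) ⬝ c.consT (c.headT (.var 4)) (.var 5)) <|
      d.ite (c.nilT (.var 5)) (.var 6)
        (.var 0 ⬝ .var 0 ⬝ (.const e ⬝ .var 4 ⬝ c.headT (.var 5)) ⬝ c.tailT (.var 5))

/-- The term whose self-application is the execution of a dialogue. -/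
def runT : Term A := d.lam 0 (d.lam 4 (d.lam 5 (c.runBody d q e)))

/-- The environment of an execution. -/
def runEnv (env : ℕ → A) : ℕ → A :=
  upd env (some 0) (d.clo env (some 0) (d.lam 4 (d.lam 5 (c.runBody d q e))))

/-- The execution of the dialogue of `env 1` with continuation `env 2`. -/
def run (env : ℕ → A) (x y : A) : Part A :=
  m.ap (Part.some (d.clo (upd (c.runEnv d q e env) (some 4) x) (some 5) (c.runBody d q e)))
    (Part.some y)

variable {q e}

theorem eval_run (env env' : ℕ → A) (x y : A) (h : env' 0 = c.runEnv d q e env 0) {s t : Term A}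
    (hs : s.eval m env' = Part.some x) (ht : t.eval m env' = Part.some y) :
    (Term.var 0 ⬝ .var 0 ⬝ s ⬝ t).eval m env' = c.run d q e env x y := by
  simp [h, hs, ht, runEnv, run]

/-- The environment in which one execution step is evaluated. -/
def stepEnv (q e : A) (env : ℕ → A) (x y w : A) : ℕ → A :=
  upd (upd (upd (c.runEnv d q e env) (some 4) x) (some 5) y) (some 6) w

theorem approx_run (hq : c.IsGuard q) {env : ℕ → A} {x y w : A}
    (hw : m (env 1) x = Part.some w) (hw' : ∃ v, w = c.pair c.tt v ∨ w = c.pair c.ff v) :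
    d.Approx (Term.eval m (c.stepEnv d q e env x y w) <|
      d.ite (c.fstT (.var 6)) (.var 2 ⬝ c.sndT (.var 6) ⬝ c.consT (c.headT (.var 4)) (.var 5)) <|
      d.ite (c.nilT (.var 5)) (.var 6)
        (.var 0 ⬝ .var 0 ⬝ (.const e ⬝ .var 4 ⬝ c.headT (.var 5)) ⬝ c.tailT (.var 5)))
      (c.run d q e env x y) := by
  refine Approx.trans ?_ (d.approx_clo _ _ _ _)
  refine d.approx_letIn ?_
  rw [← m.ap_some_some] at hw
  obtain ⟨v, rfl | rfl⟩ := hw'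
  · simp [runEnv, hw, hq.1]
  · simp [runEnv, hw, hq.2]

theorem run_tt (hq : c.IsGuard q) {env : ℕ → A} {z x : A} {l r : List A}
    (h : m (env 1) (c.code (z :: l)) = Part.some (c.pair c.tt x)) :
    d.Approx (m.ap (m (env 2) x) (Part.some (c.code (z :: r))))
      (c.run d q e env (c.code (z :: l)) (c.code r)) := by
  refine Approx.trans ?_ (c.approx_run d hq h ⟨x, .inl rfl⟩)
  refine Approx.trans (.of_eq ?_) (approx_ite_tt c ?_)
  · have h1 := c.eval_headT (t := .var 4) (env := c.stepEnv d q e env (c.code (z :: l)) (c.code r)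
      (c.pair c.tt x)) (a := z) (l := l) (by simp [stepEnv])
    have h2 := c.eval_consT (t := .var 5) (l := r) h1 (by simp [stepEnv])
    rw [Term.eval_app, h2, ← m.ap_some_some]
    simp [stepEnv, runEnv]
  · simp [stepEnv]

theorem run_ff_nil (hq : c.IsGuard q) {env : ℕ → A} {z x : A}
    (h : m (env 1) z = Part.some (c.pair c.ff x)) :
    c.run d q e env z (c.code []) = Part.some (c.pair c.ff x) := by
  refine Approx.eq_some (d := d) <| Approx.trans ?_ (c.approx_run d hq h ⟨x, .inr rfl⟩)
  refine Approx.trans ?_ (approx_ite_ff c (by simp [stepEnv]))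
  refine Approx.trans (.of_eq ?_) (approx_ite_tt c (c.eval_nilT_nil (by simp [stepEnv])))
  simp [stepEnv]

/-- One turn of the loop: the question has an answer in the remaining list, which moves to the
consumed part. -/
theorem run_ff_cons (hq : c.IsGuard q)
    (he : ∀ (l : List A) (a : A), m.ap (m.ap (Part.some e) (Part.some (c.code l))) (Part.some a) =
      Part.some (c.code (l ++ [a])))
    {env : ℕ → A} {x y : A} {l r : List A}
    (h : m (env 1) (c.code l) = Part.some (c.pair c.ff x)) :
    d.Approx (c.run d q e env (c.code (l ++ [y])) (c.code r))
      (c.run d q e env (c.code l) (c.code (y :: r))) := by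
  refine Approx.trans ?_ (c.approx_run d hq h ⟨x, .inr rfl⟩)
  refine Approx.trans ?_ (approx_ite_ff c (by simp [stepEnv]))
  refine Approx.trans (.of_eq ?_)
    (approx_ite_ff c (c.eval_nilT_cons (a := y) (l := r) (by simp [stepEnv])))
  have h1 := c.eval_headT (t := .var 5) (env := c.stepEnv d q e env (c.code l) (c.code (y :: r))
    (c.pair c.ff x)) (a := y) (l := r) (by simp [stepEnv])
  refine (c.eval_run d _ _ _ _ (by simp [stepEnv, runEnv]) ?_ ?_).symm
  · simp only [Term.eval_app, h1]
    simp [stepEnv, he]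
  · exact c.eval_tailT (a := y) (by simp [stepEnv])

/-- This is the purpose of the guard. Strictness forces every subterm of a convergent run to
converge, in particular `q` applied to the output of `a`, so that this output is a question or a
result. -/
theorem run_dom (hd : d.Strict) (hq : c.IsStrictGuard q) {env : ℕ → A} {x y : A}
    (h : (c.run d q e env x y).Dom) :
    ∃ v, m (env 1) x = Part.some (c.pair c.tt v) ∨ m (env 1) x = Part.some (c.pair c.ff v) := by
  rw [run, ← (d.approx_clo _ _ _ _).2 hd, runBody, letIn, Term.eval_app] at h
  obtain ⟨y', hy'⟩ := Part.dom_iff_mem.1 h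
  obtain ⟨_, -, w, hw, -⟩ := PartialApp.mem_ap.1 hy'
  obtain ⟨q', hq', w', hw', hww⟩ := PartialApp.mem_ap.1 hw
  cases Part.mem_some_iff.1 hq'
  have h1 : m (env 1) x = Part.some w' := by
    refine Part.eq_some_iff.2 ?_
    simpa [runEnv, m.ap_some_some] using hw'
  obtain ⟨v, rfl | rfl⟩ := hq w' (Part.dom_iff_mem.2 ⟨w, hww⟩)
  exacts [⟨v, .inl h1⟩, ⟨v, .inr h1⟩]

variable (q e) in
/-- Run the dialogue of `a`, and then the dialogue of the value of `k` at the result. -/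
def bindElt (a k : A) : A :=
  d.clo (upd (upd d.env₀ (some 1) a) (some 2) k) (some 3)
    (c.runT d q e ⬝ c.runT d q e ⬝ c.consT (c.headT (.var 3)) (.const (c.code [])) ⬝
      c.tailT (.var 3))

theorem exists_bindElt : ∃ r, ∀ a k, m.ap (m.ap (Part.some r) (Part.some a)) (Part.some k) =
    Part.some (c.bindElt d q e a k) :=
  ⟨d.clo d.env₀ (some 1) (d.lam 2 (d.lam 3 (c.runT d q e ⬝ c.runT d q e ⬝
    c.consT (c.headT (.var 3)) (.const (c.code [])) ⬝ c.tailT (.var 3)))), fun a k => by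
    rw [clo_abs_app, clo_abs_app]; rfl⟩

/-- The dialogue steps of `a` at `z` along the proper prefixes of `u` are questions. -/
def Asks (c : Combinators m) (a z : A) (u : List A) : Prop :=
  ∀ i < u.length, ∃ v, m a (c.code (z :: u.take i)) = Part.some (c.pair c.ff v)

-- Started on `[z]`, the run reaches the state with `u` consumed, because `a` asks a question at
-- each proper prefix of `u`. The induction removes the last answer of `u` and returns it to the
-- remaining list. Only the values of variables 1 and 2 matter afterwards, so the rest of the
-- environment is hidden.
variable (q e) in
theorem bind_approx
    (he : ∀ (l : List A) (a : A), m.ap (m.ap (Part.some e) (Part.some (c.code l))) (Part.some a) =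
      Part.some (c.code (l ++ [a])))
    (hq : c.IsGuard q) (a k z : A) (u w : List A) (hu : c.Asks a z u) :
    ∃ env : ℕ → A, env 1 = a ∧ env 2 = k ∧
      d.Approx (c.run d q e env (c.code (z :: u)) (c.code w))
        (m (c.bindElt d q e a k) (c.code (z :: (u ++ w)))) := by
  let env := upd (upd (upd d.env₀ (some 1) a) (some 2) k) (some 3) (c.code (z :: (u ++ w)))
  refine ⟨env, by simp [env], by simp [env], ?_⟩
  have h1 : d.Approx (c.run d q e env (c.code [z]) (c.code (u ++ w)))
      (m (c.bindElt d q e a k) (c.code (z :: (u ++ w)))) := by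
    rw [← m.ap_some_some]
    refine Approx.trans (.of_eq ?_) (d.approx_clo _ _ _ _)
    have h2 : (Term.var 3).eval m env = Part.some (c.code (z :: (u ++ w))) := by simp [env]
    change _ = Term.eval m env _
    have h4 := c.eval_headT h2
    have h3 := c.eval_consT (t := .const (c.code [])) (l := []) h4 (by simp)
    rw [Term.eval_app, Term.eval_app, c.eval_tailT h2, h3]
    simp [runT, run, runEnv]
  refine Approx.trans ?_ h1
  have henv : env 1 = a := by simp [env]
  clear h1
  clear_value env
  induction u using List.reverseRecOn generalizing w with
  | nil => exact .refl _
  | append_singleton u y ih =>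
    obtain ⟨v, hv⟩ := hu u.length (by simp)
    rw [List.take_left] at hv
    have h2 := c.run_ff_cons d hq he (y := y) (r := w) (henv ▸ hv)
    rw [List.append_assoc]
    refine Approx.trans h2 (ih (y :: w) fun i hi => ?_)
    obtain ⟨v, hv⟩ := hu i (by simp; omega)
    rw [List.take_append_of_le_length hi.le] at hv
    exact ⟨v, hv⟩

section Bind

variable (he : ∀ (l : List A) (a : A),
  m.ap (m.ap (Part.some e) (Part.some (c.code l))) (Part.some a) =
    Part.some (c.code (l ++ [a])))

include he

theorem bind_ff (hq : c.IsGuard q) {a k z v : A} {u : List A} (hu : c.Asks a z u)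
    (h : m a (c.code (z :: u)) = Part.some (c.pair c.ff v)) :
    m (c.bindElt d q e a k) (c.code (z :: u)) = Part.some (c.pair c.ff v) := by
  obtain ⟨env, rfl, rfl, h1⟩ := c.bind_approx d q e he hq a k z u [] hu
  rw [List.append_nil] at h1
  exact h1.of_eq_some (c.run_ff_nil d hq h)

theorem bind_tt (hq : c.IsGuard q) {a k z x : A} {u : List A} (hu : c.Asks a z u)
    (h : m a (c.code (z :: u)) = Part.some (c.pair c.tt x)) (w : List A) :
    d.Approx (m.ap (m k x) (Part.some (c.code (z :: w))))
      (m (c.bindElt d q e a k) (c.code (z :: (u ++ w)))) := by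
  obtain ⟨env, rfl, rfl, h1⟩ := c.bind_approx d q e he hq a k z u w hu
  exact (c.run_tt d hq h).trans h1

/-- The concatenation of a dialogue of `a` and a dialogue of `b = k x` is a dialogue of the
composite. -/
theorem adjoin_bind (hq : c.IsGuard q) {f : A →. A} {a k z x y b : A}
    (hx : x ∈ c.adjoin f a z) (hb : m k x = Part.some b) (hy : y ∈ c.adjoin f b z) :
    y ∈ c.adjoin f (c.bindElt d q e a k) z := by
  obtain ⟨u, hu, hux⟩ := c.mem_adjoin.1 hx
  obtain ⟨w, hw, hwy⟩ := c.mem_adjoin.1 hy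
  have hasks (i : ℕ) (hi : i ≤ u.length) : c.Asks a z (u.take i) := fun j hj => by
    rw [List.length_take] at hj
    obtain ⟨v, hv, -⟩ := hu j (by omega)
    exact ⟨v, by rwa [List.take_take, min_eq_left (by omega)]⟩
  have htt (w : List A) {v : A} (h : m b (c.code (z :: w)) = Part.some v) :
      m (c.bindElt d q e a k) (c.code (z :: (u ++ w))) = Part.some v := by
    refine (c.bind_tt d he hq ?_ hux w).of_eq_some ?_
    · simpa using hasks u.length le_rfl
    · rwa [hb, m.ap_some_some]
  refine c.mem_adjoin.2 ⟨u ++ w, fun i hi => ?_, htt w hwy⟩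
  by_cases hiu : i < u.length
  · obtain ⟨v, hv, hfv⟩ := hu i hiu
    refine ⟨v, ?_, ?_⟩
    · rw [List.take_append_of_le_length hiu.le]
      exact c.bind_ff d he hq (hasks i hiu.le) hv
    · rwa [List.getElem_append_left hiu]
  · obtain ⟨j, rfl⟩ := Nat.exists_eq_add_of_le (not_lt.1 hiu)
    obtain ⟨v, hv, hfv⟩ := hw j (by simpa using hi)
    refine ⟨v, ?_, ?_⟩
    · rw [List.take_length_add_append]
      exact htt _ hv
    · simpa using hfv

/-- The dialogue `t` of the composite is cut at the first prefix on which `a` does not ask a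
question. Up to there it is a dialogue of `a`, and the rest is a dialogue of `k x`. -/
theorem of_adjoin_bind [Nontrivial A] (hd : d.Strict) (hq : c.IsGuard q) (hq' : c.IsStrictGuard q)
    {f : A →. A} {a k z y : A} (hy : y ∈ c.adjoin f (c.bindElt d q e a k) z) :
    ∃ x ∈ c.adjoin f a z, ∃ b ∈ m k x, y ∈ c.adjoin f b z := by
  classical
  obtain ⟨t, ht, hty⟩ := c.mem_adjoin.1 hy
  have hex : ∃ i, i ≤ t.length ∧ ¬ ∃ v, m a (c.code (z :: t.take i)) =
      Part.some (c.pair c.ff v) := by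
    -- If `a` still asked a question after all of `t`, the composite would ask it too, instead of
    -- returning `y`.
    by_contra! hcon
    obtain ⟨v, hv⟩ := hcon t.length le_rfl
    rw [List.take_length] at hv
    have h1 := c.bind_ff d he hq (k := k) (fun i hi => hcon i hi.le) hv
    rw [hty] at h1
    exact c.tt_ne_ff (c.pair_inj (Part.some_inj.1 h1)).1
  obtain ⟨hi, hi'⟩ := Nat.find_spec hex
  have hmin (j : ℕ) (hj : j < Nat.find hex) : ∃ v, m a (c.code (z :: t.take j)) =
      Part.some (c.pair c.ff v) := by
    by_contra hcon
    exact Nat.find_min hex hj ⟨by omega, hcon⟩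
  generalize Nat.find hex = i at hi hi' hmin
  have hasks (j : ℕ) (hj : j ≤ i) : c.Asks a z (t.take j) := fun l hl => by
    rw [List.length_take] at hl
    rw [List.take_take, min_eq_left (by omega)]
    exact hmin l (by omega)
  -- The composite converges on every prefix of its dialogue. By `run_dom` the output of `a` at the
  -- cut is tagged, and it is not a question, so it is a result.
  obtain ⟨x, hx⟩ : ∃ x, m a (c.code (z :: t.take i)) = Part.some (c.pair c.tt x) := by
    have hdom : (m (c.bindElt d q e a k) (c.code (z :: t.take i))).Dom := by
      rcases hi.lt_or_eq with hlt | rfl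
      · obtain ⟨v, hv, -⟩ := ht i hlt
        rw [hv]; trivial
      · rw [List.take_length, hty]; trivial
    obtain ⟨env, henv, -, h1⟩ := c.bind_approx d q e he hq a k z _ [] (hasks i le_rfl)
    rw [List.append_nil] at h1
    rw [← h1.2 hd] at hdom
    obtain ⟨v, hv | hv⟩ := c.run_dom d hd hq' hdom
    · exact ⟨v, henv ▸ hv⟩
    · exact absurd ⟨v, henv ▸ hv⟩ hi'
  have key (w : List A) := (c.bind_tt d he hq (k := k) (hasks i le_rfl) hx w).2 hd
  have hb : ∃ b, m k x = Part.some b := by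
    have h1 := key (t.drop i)
    rw [List.take_append_drop, hty] at h1
    obtain ⟨b, hb, -⟩ := PartialApp.mem_ap.1 (Part.eq_some_iff.1 h1)
    exact ⟨b, Part.eq_some_iff.2 hb⟩
  obtain ⟨b, hb⟩ := hb
  simp only [hb, m.ap_some_some] at key
  refine ⟨x, c.mem_adjoin.2 ⟨t.take i, fun j hj => ?_, hx⟩, b, by simp [hb],
    c.mem_adjoin.2 ⟨t.drop i, fun j hj => ?_, ?_⟩⟩
  -- Before the cut the composite forwards the question of `a`, so the two questions agree and `f`
  -- gives the same answer.
  · rw [List.length_take] at hj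
    obtain ⟨v, hv, hfv⟩ := ht j (by omega)
    obtain ⟨v', hv'⟩ := hmin j (by omega)
    have h1 := c.bind_ff d he hq (k := k) (hasks j (by omega)) hv'
    rw [hv, Part.some_inj] at h1
    rw [← (c.pair_inj h1).2] at hv'
    refine ⟨v, ?_, ?_⟩
    · rwa [List.take_take, min_eq_left (by omega)]
    · rwa [List.getElem_take]
  · rw [List.length_drop] at hj
    obtain ⟨v, hv, hfv⟩ := ht (i + j) (by omega)
    refine ⟨v, ?_, ?_⟩
    · rw [key, ← hv, List.take_add]
    · rwa [List.getElem_drop]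
  · rw [key, List.take_append_drop, hty]

end Bind

/-- The dialogue of `x` at `y`, as a program with an argument that is not used. -/
def appElt (x y : A) : A :=
  d.clo (upd (upd d.env₀ (some 1) x) (some 2) y) (some 3)
    (.var 1 ⬝ c.consT (.var 2) (c.tailT (.var 3)))

theorem exists_appElt : ∃ r, ∀ x y, m.ap (m.ap (Part.some r) (Part.some x)) (Part.some y) =
    Part.some (c.appElt d x y) :=
  ⟨d.clo d.env₀ (some 1) (d.lam 2 (d.lam 3 (.var 1 ⬝ c.consT (.var 2) (c.tailT (.var 3))))),
    fun x y => by rw [clo_abs_app, clo_abs_app]; rfl⟩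

theorem approx_appElt (x y z : A) (l : List A) :
    d.Approx (m x (c.code (y :: l))) (m (c.appElt d x y) (c.code (z :: l))) := by
  rw [← m.ap_some_some, ← m.ap_some_some]
  refine Approx.trans (.of_eq ?_) (d.approx_clo _ _ _ _)
  have h1 := c.eval_tailT (t := .var 3) (a := z) (l := l) (m := m)
    (env := upd (upd (upd d.env₀ (some 1) x) (some 2) y) (some 3) (c.code (z :: l))) (by simp)
  rw [Term.eval_app, c.eval_consT (a := y) (by simp) h1]
  simp

theorem adjoin_mono {f : A →. A} {a b a' b' : A}
    (h : ∀ l, m a (c.code (b :: l)) ≤ m a' (c.code (b' :: l))) :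
    c.adjoin f a b ≤ c.adjoin f a' b' := by
  have h' (l : List A) {v : A} (hv : m a (c.code (b :: l)) = Part.some v) :
      m a' (c.code (b' :: l)) = Part.some v :=
    Part.eq_some_iff.2 (h l _ (Part.eq_some_iff.1 hv))
  intro x hx
  obtain ⟨u, hu, hux⟩ := c.mem_adjoin.1 hx
  refine c.mem_adjoin.2 ⟨u, fun i hi => ?_, h' _ hux⟩
  obtain ⟨v, hv, hfv⟩ := hu i hi
  exact ⟨v, h' _ hv, hfv⟩

theorem adjoin_appElt (f : A →. A) (x y z : A) :
    d.Approx (c.adjoin f x y) (c.adjoin f (c.appElt d x y) z) :=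
  ⟨c.adjoin_mono fun l => (c.approx_appElt d x y z l).1, fun hd =>
    le_antisymm (c.adjoin_mono fun l => (c.approx_appElt d x y z l).1)
      (c.adjoin_mono fun l => ((c.approx_appElt d x y z l).2 hd).ge)⟩

/-! ### The structure `A[f]` is a weak pca -/

/-- The function represented by `a`, as a program that asks no questions. -/
def wrap (a : A) : A :=
  c.clo (upd c.env₀ (some 1) a) (some 3) (c.pairT (.const c.tt) (.var 1 ⬝ c.headT (.var 3)))

theorem exists_wrap : ∃ r, ∀ a, m.ap (Part.some r) (Part.some a) = Part.some (c.wrap a) :=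
  ⟨c.clo c.env₀ (some 1)
    (c.lam 3 (c.pairT (.const c.tt) (.var 1 ⬝ c.headT (.var 3)))), fun x => by
    rw [clo_abs_app]; rfl⟩

theorem adjoin_wrap (f : A →. A) {a b x : A} (h : x ∈ m a b) :
    c.adjoin f (c.wrap a) b = Part.some x := by
  refine Part.eq_some_iff.2 (c.mem_adjoin_of_eq (c.clo_app_of ?_))
  have h1 := c.eval_headT (t := .var 3) (a := b) (l := []) (m := m)
    (env := upd (upd c.env₀ (some 1) a) (some 3) (c.code [b])) (by simp)
  rw [eval_pairT, Term.eval_app, h1]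
  simp [m.ap_some_some, Part.eq_some_iff.2 h]

/-- Wrapping turns an element into a program with the empty dialogue. The wrapping operation is
itself represented in `A`, and must be wrapped to act in `A[f]`. -/
theorem le_adjoin (f : A →. A) : Le m (c.adjoin f) := by
  obtain ⟨r, hr⟩ := c.exists_wrap
  refine ⟨c.wrap r, fun a b x hx => ?_⟩
  rw [c.adjoin_wrap f (x := c.wrap a) (by rw [← m.ap_some_some, hr]; simp), PartialApp.ap_some_some,
    c.adjoin_wrap f hx]
  simp

theorem exists_adjoin_app₂ (f : A →. A) {r : A} {F : A → A → A}
    (h : ∀ a b, m.ap (m.ap (Part.some r) (Part.some a)) (Part.some b) = Part.some (F a b)) :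
    ∃ r', ∀ a b, (c.adjoin f).ap (c.adjoin f r' a) (Part.some b) = Part.some (F a b) := by
  obtain ⟨w, hw⟩ := c.exists_wrap
  refine ⟨c.wrap (c.clo c.env₀ (some 0) (.const w ⬝ (.const r ⬝ .var 0))), fun a b => ?_⟩
  obtain ⟨y, hy, b', hb', h1⟩ := PartialApp.mem_ap.1 (Part.eq_some_iff.1 (h a b))
  cases Part.mem_some_iff.1 hb'
  rw [c.adjoin_wrap f (x := c.wrap y), PartialApp.ap_some_some, c.adjoin_wrap f h1]
  rw [← m.ap_some_some, c.clo_app_of (v := c.wrap y)]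
  · simp
  · simp [Part.eq_some_iff.2 hy, hw]

/-- Two choices of combinators play different roles: `c` fixes the coding used by `A[f]` and may be
nonstrict, while `d` builds the composite programs. Strictness is needed only of `d`. -/
theorem exists_adjoin_combinators (hq : c.IsGuard q) (f : A →. A) : ∃ K S : A,
    (∀ a b : A, (c.adjoin f).ap (c.adjoin f K a) (Part.some b) = Part.some a) ∧
    (∀ a b : A, ((c.adjoin f).ap (c.adjoin f S a) (Part.some b)).Dom) ∧
    (∀ a b z x : A, x ∈ (c.adjoin f).ap (c.adjoin f a z) (c.adjoin f b z) →
      x ∈ (c.adjoin f).ap ((c.adjoin f).ap (c.adjoin f S a) (Part.some b)) (Part.some z)) ∧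
    (Nontrivial A → d.Strict → c.IsStrictGuard q → ∀ a b z x : A,
      x ∈ (c.adjoin f).ap ((c.adjoin f).ap (c.adjoin f S a) (Part.some b)) (Part.some z) →
      x ∈ (c.adjoin f).ap (c.adjoin f a z) (c.adjoin f b z)) := by
  obtain ⟨K, hK⟩ := c.exists_adjoin_app₂ f (r := c.K) (F := fun a _ => a) (fun a b => by simp)
  obtain ⟨e, he⟩ := c.exists_snoc
  obtain ⟨β, hβ⟩ := c.exists_bindElt d (q := q) (e := e)
  obtain ⟨π, hπ⟩ := c.exists_appElt d
  -- The continuations of `S a b z`: after `a z` has returned `x`, `k₁ b` starts `b z`; after that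
  -- has returned `y`, `k₂ x` starts the dialogue of `x` at `y`, which ignores `z`.
  let k₂ : A → A := fun x => d.clo (upd d.env₀ (some 8) x) (some 9) (.const π ⬝ .var 8 ⬝ .var 9)
  let k₁ : A → A := fun b => d.clo (upd d.env₀ (some 7) b) (some 8)
    (.const β ⬝ .var 7 ⬝ d.lam 9 (.const π ⬝ .var 8 ⬝ .var 9))
  have hk₂ (x y : A) : m (k₂ x) y = Part.some (c.appElt d x y) := by
    rw [← m.ap_some_some]
    exact d.clo_app_of (by simp [hπ])
  have hk₁ (b x : A) : m (k₁ b) x = Part.some (c.bindElt d q e b (k₂ x)) := by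
    rw [← m.ap_some_some]
    exact d.clo_app_of (by simp [hβ, k₂]; rfl)
  obtain ⟨S, hS⟩ := c.exists_adjoin_app₂ f (F := fun a b => c.bindElt d q e a (k₁ b))
    (r := d.clo d.env₀ (some 6) (d.lam 7 (.const β ⬝ .var 6 ⬝ (d.lam 8
      (.const β ⬝ .var 7 ⬝ d.lam 9 (.const π ⬝ .var 8 ⬝ .var 9)))))) (fun a b => by
      rw [clo_abs_app]
      exact d.clo_app_of (by simp [hβ, k₁]; rfl))
  refine ⟨K, S, hK, fun a b => by rw [hS]; trivial, fun a b z x hx => ?_,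
    fun _ hd hq' a b z x hx => ?_⟩
  · rw [hS, PartialApp.ap_some_some]
    obtain ⟨y, hy, w, hw, hx⟩ := PartialApp.mem_ap.1 hx
    refine c.adjoin_bind d he hq hy (hk₁ b y) (c.adjoin_bind d he hq hw (hk₂ y w) ?_)
    exact (c.adjoin_appElt d f y w z).1 x hx
  · rw [hS, PartialApp.ap_some_some] at hx
    obtain ⟨y, hy, b', hb', hx⟩ := c.of_adjoin_bind d he hd hq hq' hx
    rw [hk₁, Part.mem_some_iff] at hb'
    subst hb'
    obtain ⟨w, hw, b', hb', hx⟩ := c.of_adjoin_bind d he hd hq hq' hx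
    rw [hk₂, Part.mem_some_iff] at hb'
    subst hb'
    rw [← (c.adjoin_appElt d f y w z).2 hd] at hx
    exact PartialApp.mem_ap.2 ⟨y, hy, w, hw, hx⟩

theorem adjoin_isWeakPCA (f : A →. A) : IsWeakPCA (c.adjoin f) := by
  obtain ⟨K, S, hK, hd, hS, -⟩ := c.exists_adjoin_combinators c c.isGuard_I f
  exact ⟨⟨K, S, hK, hd, hS⟩⟩

theorem adjoin_isPCA [Nontrivial A] (hd : d.Strict) (hq : c.IsGuard q) (hq' : c.IsStrictGuard q)
    (f : A →. A) : IsPCA (c.adjoin f) := by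
  obtain ⟨K, S, hK, hdom, hS, hS'⟩ := c.exists_adjoin_combinators d hq f
  exact ⟨K, S, hK, hdom, fun a b z => Part.ext fun x =>
    ⟨hS' inferInstance hd hq' a b z x, hS a b z x⟩⟩

end Combinators

namespace Combinators

variable {A : Type u} {m : PartialApp A} (c : Combinators m)

/-! ### The universal property of `A[f]` -/

/-- The program asks its own argument as its only question, and returns the answer; the dialogue at
`a` is `[f a]`. -/
theorem representable_adjoin (f : A →. A) : Representable (c.adjoin f) f := by
  let t : Term A := c.ite (c.nilT (c.tailT (.var 0)))
    (c.pairT (.const c.ff) (c.headT (.var 0)))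
    (c.pairT (.const c.tt) (c.headT (c.tailT (.var 0))))
  refine representable_iff.2 ⟨c.clo c.env₀ (some 0) t, fun a x hx => c.mem_adjoin.2 ⟨[x], ?_, ?_⟩⟩
  · intro i hi
    obtain rfl : i = 0 := by simpa using hi
    refine ⟨a, ?_, hx⟩
    have h0 : (Term.var 0).eval m (upd c.env₀ (some 0) (c.code [a])) = Part.some (c.code [a]) := by
      simp
    rw [List.take_zero, ← m.ap_some_some]
    refine c.clo_app_of
      ((approx_ite_tt c (c.eval_nilT_nil (c.eval_tailT h0))).of_eq_some ?_)
    rw [eval_pairT, c.eval_headT h0]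
    simp
  · have h0 : (Term.var 0).eval m (upd c.env₀ (some 0) (c.code [a, x])) =
      Part.some (c.code [a, x]) := by simp
    rw [← m.ap_some_some]
    refine c.clo_app_of
      ((approx_ite_ff c (c.eval_nilT_cons (c.eval_tailT h0))).of_eq_some ?_)
    rw [eval_pairT, c.eval_headT (c.eval_tailT h0)]
    simp

/-- A loop in `n` simulates `a` on the answers so far, using `r` for every application of `m`. A
question is answered by `φ` and the answer appended; a result ends the loop. -/
theorem adjoin_le {n : PartialApp A} (d : Combinators n) (h : Le m n) {f : A →. A}
    (hf : Representable n f) : Le (c.adjoin f) n := by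
  obtain ⟨r, hr⟩ := h
  obtain ⟨φ, hφ⟩ := representable_iff.1 hf
  obtain ⟨e, he⟩ := c.exists_snoc
  obtain ⟨g, hg⟩ := c.exists_single
  have hr₁ {a b x : A} := ap_of_realizer (a := a) (b := b) (x := x) hr
  have hr₂ {a b b' x : A} := ap_of_realizer₂ (a := a) (b := b) (b' := b') (x := x) hr
  have hK (a b : A) : m.ap (m.ap (Part.some c.tt) (Part.some a)) (Part.some b) = Part.some a := by
    simp [tt]
  have hKI (a b : A) : m.ap (m.ap (Part.some c.ff) (Part.some a)) (Part.some b) = Part.some b := by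
    simp [ff]
  let R : Term A → Term A → Term A := fun t s => .const r ⬝ t ⬝ s
  -- The tag is a Boolean of `c`, whereas `d.ite` needs one of `d`; applying the tag, in the sense
  -- of `m`, to `d.tt` and `d.ff` converts it.
  let step : Term A := d.ite
    (R (R (R (.var 3) (.const c.tt)) (.const d.tt)) (.const d.ff))
    (R (.var 3) (.const c.ff))
    (.var 0 ⬝ .var 0 ⬝ .var 1 ⬝ R (R (.const e) (.var 2)) (.const φ ⬝ R (.var 3) (.const c.ff)))
  let body : Term A := d.letIn 3 (R (.var 1) (.var 2)) step
  let W : A := d.clo d.env₀ (some 0) (d.lam 1 (d.lam 2 body))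
  let env : A → ℕ → A := fun a => upd (upd d.env₀ (some 0) W) (some 1) a
  -- Induction on the answers still to come, `u₂`, with those already collected, `u₁`, varying.
  have key (a b x : A) (u₂ u₁ : List A) (hu : c.IsDialogue f a b (u₁ ++ u₂))
      (hx : m a (c.code (b :: (u₁ ++ u₂))) = Part.some (c.pair c.tt x)) :
      n.ap (Part.some (d.clo (env a) (some 2) body)) (Part.some (c.code (b :: u₁))) =
        Part.some x := by
    induction u₂ generalizing u₁ with
    | nil =>
      rw [List.append_nil, ← m.ap_some_some] at hx
      refine d.clo_app_of ((d.approx_letIn (a := c.pair c.tt x) ?_).of_eq_some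
        ((approx_ite_tt d ?_).of_eq_some ?_))
      · simpa [R, env] using hr₁ hx
      · simp [R, hr₁ (c.pair_ap_tt _ _), hr₂ (hK _ _)]
      · simp [R, hr₁ (c.pair_ap_ff _ _)]
    | cons y u₂ ih =>
      obtain ⟨v, hv, hfv⟩ := hu u₁.length (by simp)
      rw [List.take_left, ← m.ap_some_some] at hv
      have hφ' : n.ap (Part.some φ) (Part.some v) = Part.some y := by
        rw [n.ap_some_some]
        exact Part.eq_some_iff.2 (hφ v y (by simpa using hfv))
      refine d.clo_app_of ((d.approx_letIn (a := c.pair c.ff v) ?_).of_eq_some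
        ((approx_ite_ff d ?_).of_eq_some ?_))
      · simpa [R, env] using hr₁ hv
      · simp [R, hr₁ (c.pair_ap_tt _ _), hr₂ (hKI _ _)]
      · have h1 := ih (u₁ ++ [y]) (by simpa using hu) (by simpa using hx)
        simp [R, hr₁ (c.pair_ap_ff _ _), hφ', hr₂ (he _ _), env, W]
        exact h1
  refine ⟨d.clo d.env₀ (some 4) (d.lam 5 (.const (d.clo (upd d.env₀ (some 0) W) (some 1)
    (d.lam 2 body)) ⬝ .var 4 ⬝ R (.const g) (.var 5))), fun a b x hx => ?_⟩
  obtain ⟨u, hu, hux⟩ := c.mem_adjoin.1 hx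
  have h1 := key a b x u [] hu hux
  rw [← n.ap_some_some, clo_abs_app]
  refine Part.eq_some_iff.1 (d.clo_app_of ?_)
  simpa [R, hr₁ (hg _)] using h1

theorem isomorphic_adjoin {f : A →. A} (hf : Representable m f) : Isomorphic m (c.adjoin f) :=
  .of_le (c.le_adjoin f) (c.adjoin_le c ⟨c.I, fun a b x hx => by
    rwa [← m.ap_some_some, c.ap_I, m.ap_some_some]⟩ hf)

/-- The universal property is used twice: `A[g][f]` lies above `A` and represents `f`, hence lies
above `A[f]`; it also represents `g`. -/
theorem adjoin_adjoin_le {f g : A →. A} (cf : Combinators (c.adjoin f))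
    (cg : Combinators (c.adjoin g)) : Le (cf.adjoin g) (cg.adjoin f) := by
  obtain ⟨d⟩ := cg.adjoin_isWeakPCA f
  refine cf.adjoin_le d ?_ ((c.representable_adjoin g).of_le d (cg.le_adjoin f))
  exact c.adjoin_le d ((c.le_adjoin g).trans d (cg.le_adjoin f)) (cg.representable_adjoin f)

/-- The constant program with output `p I I` never returns a result, because `I ≠ ⊤`. -/
theorem adjoin_not_isTotal [Nontrivial A] (f : A →. A) : ¬ IsTotal (c.adjoin f) := by
  intro h
  obtain ⟨x, hx⟩ := Part.dom_iff_mem.1 (h (c.k (c.pair c.I c.I)) c.I)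
  obtain ⟨u, -, hu⟩ := c.mem_adjoin.1 hx
  rw [c.k_app, Part.some_inj] at hu
  exact c.I_ne_tt (c.pair_inj hu).1

/-! ### Every weak pca is isomorphic to a pca -/

/-- Application of elements of the form `p ⊤ a`, applied as `a` is in `(A, m)`, and of elements
`p ⊥ (p x y)`, applied by the rule for `S x y`. -/
inductive Tagged : A → A → A → Prop
  | base (a b x : A) (h : x ∈ m a b) : Tagged (c.pair c.tt a) b x
  | subst (a a' b x y z : A) (hx : Tagged a b x) (hy : Tagged a' b y) (hz : Tagged x y z) :
    Tagged (c.pair c.ff (c.pair a a')) b z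

variable {c}

theorem tagged_base [Nontrivial A] {a b x : A} (h : c.Tagged (c.pair c.tt a) b x) : x ∈ m a b := by
  generalize ht : c.pair c.tt a = t at h
  cases h with
  | base a' _ _ h => rwa [(c.pair_inj ht).2]
  | subst a₁ a₂ _ _ _ _ => exact absurd (c.pair_inj ht).1 c.tt_ne_ff

theorem tagged_subst [Nontrivial A] {a a' b z : A}
    (h : c.Tagged (c.pair c.ff (c.pair a a')) b z) :
    ∃ x y, c.Tagged a b x ∧ c.Tagged a' b y ∧ c.Tagged x y z := by
  generalize ht : c.pair c.ff (c.pair a a') = t at h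
  cases h with
  | base a' _ _ h => exact absurd (c.pair_inj ht).1.symm c.tt_ne_ff
  | subst a₁ a₂ _ x y _ hx hy hz =>
    obtain ⟨rfl, rfl⟩ := c.pair_inj (c.pair_inj ht).2
    exact ⟨x, y, hx, hy, hz⟩

theorem tagged_unique [Nontrivial A] {a b x x' : A} (h : c.Tagged a b x) (h' : c.Tagged a b x') :
    x = x' := by
  induction h generalizing x' with
  | base a b x h => exact Part.mem_unique h (tagged_base h')
  | subst a a' b x y z hx hy hz ihx ihy ihz =>
    obtain ⟨x₁, y₁, hx₁, hy₁, hz₁⟩ := tagged_subst h'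
    obtain rfl := ihx hx₁
    obtain rfl := ihy hy₁
    exact ihz hz₁

variable (c)

/-- The partial application given by `Tagged`. -/
noncomputable def tagged : PartialApp A := fun a b =>
  ⟨∃ x, c.Tagged a b x, fun h => h.choose⟩

theorem mem_tagged [Nontrivial A] {a b x : A} : x ∈ c.tagged a b ↔ c.Tagged a b x := by
  constructor
  · rintro ⟨h, rfl⟩
    exact h.choose_spec
  · intro hx
    exact ⟨⟨x, hx⟩, tagged_unique (Exists.choose_spec (⟨x, hx⟩ : ∃ x, _)) hx⟩

theorem tagged_tt [Nontrivial A] {a b x : A} (h : m.ap (Part.some a) (Part.some b) = Part.some x) :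
    c.tagged (c.pair c.tt a) b = Part.some x :=
  Part.eq_some_iff.2 (c.mem_tagged.2 (.base a b x
    (Part.eq_some_iff.1 ((m.ap_some_some _ _).symm.trans h))))

/-- `S` only forms the formal pair `p ⊥ (p a b)`. The sole rule for such an element is
`Tagged.subst`, and its inversion is the missing half of the strict law. -/
theorem tagged_isPCA [Nontrivial A] : IsPCA c.tagged := by
  refine ⟨c.pair c.tt (c.clo c.env₀ (some 0) (c.pairT (.const c.tt) (.const c.K ⬝ .var 0))),
    c.pair c.tt (c.clo c.env₀ (some 0) (c.pairT (.const c.tt)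
      (c.lam 1 (c.pairT (.const c.ff) (c.pairT (.var 0) (.var 1)))))), fun a b => ?_,
    fun a b => ?_, fun a b z => ?_⟩
  · rw [c.tagged_tt (c.clo_app_of (v := c.pair c.tt (c.k a)) (by simp)), PartialApp.ap_some_some,
      c.tagged_tt (c.ap_k a b)]
  all_goals
    rw [c.tagged_tt (c.clo_app_of (by rw [eval_pairT, eval_abs]; simp; rfl)),
      PartialApp.ap_some_some,
      c.tagged_tt (c.clo_app_of (v := c.pair c.ff (c.pair a b)) (by simp))]
  · trivial
  · rw [PartialApp.ap_some_some]
    ext x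
    rw [c.mem_tagged, PartialApp.mem_ap]
    constructor
    · intro h
      obtain ⟨x', y', hx, hy, hz⟩ := tagged_subst h
      exact ⟨x', c.mem_tagged.2 hx, y', c.mem_tagged.2 hy, c.mem_tagged.2 hz⟩
    · rintro ⟨x', hx, y', hy, hz⟩
      exact .subst _ _ _ _ _ _ (c.mem_tagged.1 hx) (c.mem_tagged.1 hy) (c.mem_tagged.1 hz)

theorem le_tagged [Nontrivial A] : Le m c.tagged := by
  refine ⟨c.pair c.tt (c.clo c.env₀ (some 0) (c.pairT (.const c.tt) (.var 0))), fun a b x hx => ?_⟩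
  rw [c.tagged_tt (c.clo_app_of (v := c.pair c.tt a) (by simp)), PartialApp.ap_some_some,
    c.mem_tagged]
  exact .base _ _ _ hx

/-- A recursive evaluator in `m` follows the two rules. It need only converge where a derivation
exists, so the induction is on derivations and weak combinators suffice. -/
theorem tagged_le [Nontrivial A] : Le c.tagged m := by
  let body : Term A := c.ite (c.fstT (.var 1)) (c.sndT (.var 1) ⬝ .var 2)
    (.var 0 ⬝ .var 0 ⬝ (.var 0 ⬝ .var 0 ⬝ c.fstT (c.sndT (.var 1)) ⬝ .var 2)
      ⬝ (.var 0 ⬝ .var 0 ⬝ c.sndT (c.sndT (.var 1)) ⬝ .var 2))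
  let W : A := c.clo c.env₀ (some 0) (c.lam 1 (c.lam 2 body))
  refine ⟨c.clo (upd c.env₀ (some 0) W) (some 1) (c.lam 2 body), fun a b x hx => ?_⟩
  rw [← m.ap_some_some]
  refine Part.eq_some_iff.1 ?_
  replace hx := c.mem_tagged.1 hx
  induction hx with
  | base a b x h =>
    rw [clo_abs_app]
    refine c.clo_app_of ((approx_ite_tt c (by simp)).of_eq_some ?_)
    have h1 := (m.ap_some_some a b).trans (Part.eq_some_iff.2 h)
    simp [h1]
  | subst a a' b x y z hx hy hz ihx ihy ihz =>
    rw [clo_abs_app]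
    refine c.clo_app_of ((approx_ite_ff c (by simp)).of_eq_some ?_)
    simp only [clo_abs_app] at ihx ihy ihz
    simp [W, ihx, ihy, ihz]

theorem tagged_not_isTotal [Nontrivial A] : ¬ IsTotal c.tagged := by
  intro h
  obtain ⟨x, hx⟩ := Part.dom_iff_mem.1 (h (c.pair c.I c.I) c.I)
  have hx := c.mem_tagged.1 hx
  generalize ht : c.pair c.I c.I = t at hx
  cases hx with
  | base => exact c.I_ne_tt (c.pair_inj ht).1
  | subst => exact c.I_ne_ff (c.pair_inj ht).1

theorem isomorphic_isPCA (c : Combinators m) :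
    ∃ n : PartialApp A, IsPCA n ∧ Isomorphic m n := by
  rcases subsingleton_or_nontrivial A with hA | hA
  -- With one element the two tags coincide and the construction fails; but then `m` is total,
  -- because `I a` is defined, and every law holds trivially.
  · have h (p : Part A) (hp : p.Dom) (x : A) : p = Part.some x :=
      Part.eq_some_iff.2 ⟨hp, Subsingleton.elim _ _⟩
    have hm (a b : A) : (m a b).Dom := by
      rw [Subsingleton.elim a c.I, c.I_app]
      trivial
    refine ⟨m, ⟨c.K, c.S, c.K_spec, c.S_dom, fun a b z => ?_⟩, .of_le ?_ ?_⟩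
    · rw [h (m.ap (m a z) (m b z)) ⟨hm _ _, hm _ _, hm _ _⟩ a]
      exact h (m.ap (m.ap (m c.S a) (Part.some b)) (Part.some z)) ⟨c.S_dom _ _, trivial, hm _ _⟩ a
    all_goals exact ⟨c.I, fun a b x hx => by rwa [c.I_app, m.ap_some_some]⟩
  · exact ⟨c.tagged, c.tagged_isPCA, .of_le c.le_tagged c.tagged_le⟩

end Combinators

/-! ### The graph model -/

namespace GraphModel

/-- Application in the graph model `𝒫 ω`. -/
def app (a b : Set ℕ) : Set ℕ := {n | ∃ e : Finset ℕ, ↑e ⊆ b ∧ Encodable.encode (e, n) ∈ a}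

/-- The graph of a function. -/
def graph (F : Set ℕ → Set ℕ) : Set ℕ :=
  {k | ∃ (e : Finset ℕ) (n : ℕ), k = Encodable.encode (e, n) ∧ n ∈ F e}

/-- Scott continuity. -/
def Cont (F : Set ℕ → Set ℕ) : Prop :=
  ∀ b n, n ∈ F b ↔ ∃ e : Finset ℕ, ↑e ⊆ b ∧ n ∈ F e

theorem mem_graph {F : Set ℕ → Set ℕ} {e : Finset ℕ} {n : ℕ} :
    Encodable.encode (e, n) ∈ graph F ↔ n ∈ F e := by
  constructor
  · rintro ⟨e', n', h, hn⟩
    obtain ⟨rfl, rfl⟩ := Prod.mk.inj (Encodable.encode_injective h)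
    exact hn
  · exact fun h => ⟨e, n, rfl, h⟩

theorem app_graph {F : Set ℕ → Set ℕ} (hF : Cont F) (b : Set ℕ) : app (graph F) b = F b := by
  ext n
  rw [hF b n]
  exact exists_congr fun e => and_congr_right fun _ => mem_graph

theorem Cont.mono {F : Set ℕ → Set ℕ} (hF : Cont F) {a b : Set ℕ} (h : a ⊆ b) : F a ⊆ F b :=
  fun n hn => by
    obtain ⟨e, he, hn⟩ := (hF a n).1 hn
    exact (hF b n).2 ⟨e, he.trans h, hn⟩

/-- Each of the finitely many elements of `e` uses a finite part of `b`; by monotonicity the union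
of these parts serves all of them. -/
theorem Cont.exists_finset {F : Set ℕ → Set ℕ} (hF : Cont F) {b : Set ℕ} (e : Finset ℕ)
    (h : ↑e ⊆ F b) : ∃ e' : Finset ℕ, ↑e' ⊆ b ∧ ↑e ⊆ F e' := by
  classical
  induction e using Finset.induction_on with
  | empty => exact ⟨∅, by simp, by simp⟩
  | insert n e _ ih =>
    rw [Finset.coe_insert, Set.insert_subset_iff] at h
    obtain ⟨e₁, h₁, he₁⟩ := ih h.2
    obtain ⟨e₂, h₂, he₂⟩ := (hF b n).1 h.1
    refine ⟨e₁ ∪ e₂, by simp [h₁, h₂], ?_⟩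
    rw [Finset.coe_insert, Set.insert_subset_iff]
    exact ⟨hF.mono (by simp) he₂, he₁.trans (hF.mono (by simp))⟩

theorem Cont.const (a : Set ℕ) : Cont fun _ => a :=
  fun _ _ => ⟨fun h => ⟨∅, by simp, h⟩, fun ⟨_, _, h⟩ => h⟩

theorem Cont.id : Cont fun a => a := fun b n =>
  ⟨fun h => ⟨{n}, by simpa using h, by simp⟩, fun ⟨_, h, hn⟩ => h hn⟩

theorem Cont.app {F G : Set ℕ → Set ℕ} (hF : Cont F) (hG : Cont G) :
    Cont fun a => app (F a) (G a) := by
  classical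
  intro b n
  constructor
  · rintro ⟨e, he, hn⟩
    obtain ⟨e₁, h₁, he₁⟩ := hG.exists_finset e he
    obtain ⟨e₂, h₂, he₂⟩ := (hF _ _).1 hn
    exact ⟨e₁ ∪ e₂, by simp [h₁, h₂], e, he₁.trans (hG.mono (by simp)), hF.mono (by simp) he₂⟩
  · rintro ⟨e', he', e, he, hn⟩
    exact ⟨e, he.trans (hG.mono he'), hF.mono he' hn⟩

/-- An element of a graph concerns a single finite input, so continuity in the outer variable for
each fixed inner one is enough. -/
theorem Cont.graph {F : Set ℕ → Set ℕ → Set ℕ} (hF : ∀ b, Cont fun a => F a b) :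
    Cont fun a => graph (F a) := by
  intro b n
  constructor
  · rintro ⟨e, k, rfl, hk⟩
    obtain ⟨e', he', hk⟩ := (hF _ _ _).1 hk
    exact ⟨e', he', e, k, rfl, hk⟩
  · rintro ⟨e', he', e, k, rfl, hk⟩
    exact ⟨e, k, rfl, (hF _).mono he' hk⟩

/-- The graph model as a (total) partial application. -/
def papp : PartialApp (Set ℕ) := fun a b => Part.some (app a b)

theorem papp_isPCA : IsPCA papp := by
  have h₁ (a b : Set ℕ) : Cont fun z => app (app a z) (app b z) :=
    ((Cont.const a).app .id).app ((Cont.const b).app .id)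
  have h₂ (a : Set ℕ) : Cont fun b => graph fun z => app (app a z) (app b z) :=
    .graph fun z => (Cont.const _).app (Cont.id.app (.const z))
  have h₃ : Cont fun a => graph fun b => graph fun z => app (app a z) (app b z) :=
    .graph fun b => .graph fun z => (Cont.id.app (.const z)).app (.const _)
  have h₄ : Cont fun a => graph fun _ => a := .graph fun _ => .id
  refine ⟨graph fun a => graph fun _ => a,
    graph fun a => graph fun b => graph fun z => app (app a z) (app b z), ?_, ?_, ?_⟩
  · intro a b
    simp [papp, PartialApp.ap, app_graph h₄, app_graph (Cont.const a)]
  · intro a b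
    simp [papp, PartialApp.ap]
  · intro a b z
    simp [papp, PartialApp.ap, app_graph h₃, app_graph (h₂ a), app_graph (h₁ a b)]

end GraphModel

theorem exists_isTotal_isomorphic : ∃ (A B : Type) (m : PartialApp A) (n : PartialApp B),
    IsPCA m ∧ IsPCA n ∧ ¬ IsTotal m ∧ IsTotal n ∧ Isomorphic m n := by
  obtain ⟨c⟩ := GraphModel.papp_isPCA.isWeakPCA
  exact ⟨Set ℕ, Set ℕ, c.tagged, GraphModel.papp, c.tagged_isPCA, GraphModel.papp_isPCA,
    c.tagged_not_isTotal, fun _ _ => trivial, .of_le c.tagged_le c.le_tagged⟩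

/-! ### Kleene's first model -/

/-- Currying makes `S a b` the index `cur e (Nat.pair a b)`, which is always defined, and leaves the
whole evaluation of `a z (b z)` to `e`. This serves `𝒦₁` and `𝒦₁ᶠ` alike. -/
theorem isPCA_of_universal {n : PartialApp ℕ} {cur : ℕ → ℕ → ℕ} (hcur : Computable₂ cur)
    (cur_app : ∀ e a b, n (cur e a) b = n e (Nat.pair a b))
    (hn : ∀ g : ℕ → ℕ, Computable g → ∃ e, ∀ a, n e a = Part.some (g a))
    (hS : ∃ e, ∀ a b z, n e (Nat.pair (Nat.pair a b) z) = n.ap (n a z) (n b z)) : IsPCA n := by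
  have hn₂ (G : ℕ → ℕ → ℕ) (hG : Computable₂ G) :
      ∃ e, ∀ a b, n.ap (n e a) (Part.some b) = Part.some (G a b) := by
    obtain ⟨e, he⟩ := hn (fun t => G t.unpair.1 t.unpair.2)
      (hG.comp (Computable.fst.comp Computable.unpair) (Computable.snd.comp Computable.unpair))
    obtain ⟨e', he'⟩ := hn (cur e) (hcur.comp (Computable.const e) Computable.id)
    refine ⟨e', fun a b => ?_⟩
    rw [he', n.ap_some_some, cur_app, he]
    simp
  obtain ⟨K, hK⟩ := hn₂ (fun a _ => a) Computable.fst
  obtain ⟨e, he⟩ := hS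
  obtain ⟨S, hS⟩ := hn₂ (fun a b => cur e (Nat.pair a b))
    (hcur.comp (Computable.const e) (Primrec₂.natPair.to_comp))
  refine ⟨K, S, hK, fun a b => by rw [hS]; trivial, fun a b z => ?_⟩
  rw [hS, n.ap_some_some, cur_app, he]

theorem kleene_encodeCode (c : Nat.Partrec.Code) (n : ℕ) :
    kleene (Nat.Partrec.Code.encodeCode c) n = c.eval n := by
  rw [kleene, ← Nat.Partrec.Code.ofNatCode_eq, ← Nat.Partrec.Code.encodeCode_eq,
    Denumerable.ofNat_encode]

theorem partrec₂_kleene : Partrec₂ kleene := by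
  have h := Nat.Partrec.Code.eval_part.comp
    ((Computable.ofNat Nat.Partrec.Code).comp Computable.fst) (Computable.snd (α := ℕ) (β := ℕ))
  refine h.of_eq fun p => ?_
  rw [Nat.Partrec.Code.ofNatCode_eq]
  rfl

theorem exists_kleene {g : ℕ →. ℕ} (hg : Partrec g) : ∃ e, ∀ a, kleene e a = g a := by
  obtain ⟨c, rfl⟩ := Nat.Partrec.Code.exists_code.1 (Partrec.nat_iff.1 hg)
  exact ⟨_, kleene_encodeCode c⟩

/-- The index of the partial function computed by `e` when its first argument is `a`. -/
def kleeneCurry (e a : ℕ) : ℕ :=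
  Nat.Partrec.Code.encodeCode (Nat.Partrec.Code.curry (Nat.Partrec.Code.ofNatCode e) a)

theorem kleeneCurry_app (e a b : ℕ) : kleene (kleeneCurry e a) b = kleene e (Nat.pair a b) := by
  rw [kleeneCurry, kleene_encodeCode, Nat.Partrec.Code.eval_curry, kleene]

theorem computable₂_kleeneCurry : Computable₂ kleeneCurry := by
  have h := Nat.Partrec.Code.primrec₂_curry.comp
    ((Primrec.ofNat Nat.Partrec.Code).comp (Primrec.fst (α := ℕ) (β := ℕ))) Primrec.snd
  refine ((Primrec.encode.comp h).of_eq fun p => ?_).to_comp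
  rw [Nat.Partrec.Code.ofNatCode_eq, Nat.Partrec.Code.encodeCode_eq]
  rfl

theorem kleene_isPCA : IsPCA kleene := by
  refine isPCA_of_universal computable₂_kleeneCurry kleeneCurry_app
    (fun g hg => exists_kleene hg.partrec) ?_
  let a : ℕ → ℕ := fun t => t.unpair.1.unpair.1
  let b : ℕ → ℕ := fun t => t.unpair.1.unpair.2
  let z : ℕ → ℕ := fun t => t.unpair.2
  have hz : Computable z := Computable.snd.comp Computable.unpair
  have hab : Computable fun t : ℕ => t.unpair.1.unpair :=
    Computable.unpair.comp (Computable.fst.comp Computable.unpair)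
  have ha : Computable a := Computable.fst.comp hab
  have hb : Computable b := Computable.snd.comp hab
  have h1 : Partrec fun t => kleene (a t) (z t) := partrec₂_kleene.comp ha hz
  have h2 : Partrec fun t => kleene (b t) (z t) := partrec₂_kleene.comp hb hz
  have h3 : Partrec fun t => kleene.ap (kleene (a t) (z t)) (kleene (b t) (z t)) :=
    h1.bind (Partrec.bind (h2.comp Computable.fst)
      (partrec₂_kleene.comp (Computable.snd.comp Computable.fst) Computable.snd))
  obtain ⟨e, he⟩ := exists_kleene h3
  exact ⟨e, fun x y w => by simp [he, a, b, z]⟩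

/-! ### Strict combinators and a strict guard in `𝒦₁` -/

theorem exists_strict_kleene : ∃ d : Combinators kleene, d.Strict := by
  obtain ⟨K, S, hK, hd, hS⟩ := kleene_isPCA
  let d : Combinators kleene := ⟨K, S, hK, hd, fun a b z x hx => by rwa [hS]⟩
  refine ⟨d, fun a b z => ?_⟩
  have h : kleene.ap (kleene S a) (Part.some b) = Part.some (d.s a b) := d.S_app a b
  rw [← hS a b z, h, kleene.ap_some_some]

/-- For any choice of combinators the pairing is computable. The guard searches for a `v` with `w =
p ⊤ v` or `w = p ⊥ v` and then returns `w`; without such a `v` the search diverges, as required. -/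
theorem exists_isStrictGuard (c : Combinators kleene) : ∃ q, c.IsGuard q ∧ c.IsStrictGuard q := by
  have hk : Computable c.k := by
    refine Partrec.of_eq_tot (f := fun a => kleene c.K a) ?_ fun a => by rw [c.K_app]; simp
    exact partrec₂_kleene.comp (Computable.const _) Computable.id
  have hs : Computable₂ c.s := by
    refine Partrec.of_eq_tot (f := fun p : ℕ × ℕ => kleene.ap (kleene c.S p.1) (Part.some p.2)) ?_
      fun a => by rw [c.S_app]; simp
    have h1 : Partrec fun p : ℕ × ℕ => kleene c.S p.1 :=
      partrec₂_kleene.comp (Computable.const _) Computable.fst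
    refine (h1.bind (partrec₂_kleene.comp Computable.snd
      (Computable.snd.comp Computable.fst)).to₂).of_eq fun p => ?_
    simp [PartialApp.ap]
  have hpair (a : ℕ) : Computable (c.pair a) :=
    hs.comp (Computable.const _) hk
  have hdec : Computable₂ fun a b : ℕ => decide (a = b) := Primrec.eq.decide.to_comp
  have hdec' (a : ℕ) : Computable₂ fun w v : ℕ => decide (w = c.pair a v) :=
    hdec.comp Computable.fst ((hpair a).comp Computable.snd)
  have hor : Computable₂ fun w v : ℕ =>
      (decide (w = c.pair c.tt v) || decide (w = c.pair c.ff v)) :=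
    Primrec.or.to_comp.comp (hdec' _) (hdec' _)
  have hq : Partrec fun w : ℕ => (Nat.rfind fun v => Part.some
      (decide (w = c.pair c.tt v) || decide (w = c.pair c.ff v))).map fun _ => w :=
    (Partrec.rfind hor.partrec₂).map Computable.fst
  obtain ⟨q, hq⟩ := exists_kleene hq
  have hdom (w x : ℕ) (h : w = c.pair c.tt x ∨ w = c.pair c.ff x) :
      kleene q w = Part.some w := by
    rw [hq, Part.eq_some_iff, Part.mem_map_iff]
    obtain ⟨v, hv, -⟩ := Nat.rfind_min' (p := fun v =>
      decide (w = c.pair c.tt v) || decide (w = c.pair c.ff v)) (m := x) (by simpa using h)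
    exact ⟨v, hv, rfl⟩
  refine ⟨q, ⟨fun x => ?_, fun x => ?_⟩, fun w hw => ?_⟩
  · rw [kleene.ap_some_some]
    exact hdom _ x (.inl rfl)
  · rw [kleene.ap_some_some]
    exact hdom _ x (.inr rfl)
  · rw [hq] at hw
    obtain ⟨v, hv⟩ := Part.dom_iff_mem.1 hw
    obtain ⟨x, hx, -⟩ := (Part.mem_map_iff _).1 hv
    exact ⟨x, by simpa using (Nat.mem_rfind.1 hx).1⟩

theorem adjoin_kleene_isPCA (c : Combinators kleene) (f : ℕ →. ℕ) : IsPCA (c.adjoin f) := by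
  obtain ⟨d, hd⟩ := exists_strict_kleene
  obtain ⟨q, hq, hq'⟩ := exists_isStrictGuard c
  exact c.adjoin_isPCA d hd hq hq' f

namespace OracleCode

/-! ### A stack machine that executes programs with an oracle -/

theorem decode_pair (a b : ℕ) : decode (4 * Nat.pair a b + 5) = pair (decode a) (decode b) := by
  rw [decode]
  simp

theorem decode_comp (a b : ℕ) : decode (4 * Nat.pair a b + 6) = comp (decode a) (decode b) := by
  rw [show 4 * Nat.pair a b + 6 = (4 * Nat.pair a b + 1) + 5 from rfl, decode]
  have e1 : (4 * Nat.pair a b + 1) / 4 = Nat.pair a b := by omega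
  have e2 : (4 * Nat.pair a b + 1) % 4 = 1 := by omega
  simp [e1, e2]

theorem decode_prec (a b : ℕ) : decode (4 * Nat.pair a b + 7) = prec (decode a) (decode b) := by
  rw [show 4 * Nat.pair a b + 7 = (4 * Nat.pair a b + 2) + 5 from rfl, decode]
  have e1 : (4 * Nat.pair a b + 2) / 4 = Nat.pair a b := by omega
  have e2 : (4 * Nat.pair a b + 2) % 4 = 2 := by omega
  simp [e1, e2]

theorem decode_rfind' (a : ℕ) : decode (4 * a + 8) = rfind' (decode a) := by
  rw [show 4 * a + 8 = (4 * a + 3) + 5 from rfl, decode]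
  have e1 : (4 * a + 3) / 4 = a := by omega
  have e2 : (4 * a + 3) % 4 = 3 := by omega
  simp [e1, e2]

/-- Case distinction on Gödel numbers. -/
theorem index_cases (e : ℕ) : e = 0 ∨ e = 1 ∨ e = 2 ∨ e = 3 ∨ e = 4 ∨
    (∃ a b, a < e ∧ b < e ∧ (e = 4 * Nat.pair a b + 5 ∨ e = 4 * Nat.pair a b + 6 ∨
      e = 4 * Nat.pair a b + 7)) ∨ ∃ a, e = 4 * a + 8 := by
  rcases lt_or_ge e 5 with h | h
  · omega
  · have h1 := ((e - 5) / 4).unpair_left_le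
    have h2 := ((e - 5) / 4).unpair_right_le
    by_cases h3 : (e - 5) % 4 = 3
    · exact .inr (.inr (.inr (.inr (.inr (.inr ⟨(e - 5) / 4, by omega⟩)))))
    · refine .inr (.inr (.inr (.inr (.inr (.inl ⟨((e - 5) / 4).unpair.1,
        ((e - 5) / 4).unpair.2, by omega, by omega, ?_⟩)))))
      rw [Nat.pair_unpair]
      omega

/-- A state of the machine: the current value, and a stack of instructions `(t, e, d)`. -/
abbrev State : Type := ℕ × List (ℕ × ℕ × ℕ)

/-- The step for the instruction to execute the program `e`, at the value `v`. -/
def evalStep (e v : ℕ) (k : List (ℕ × ℕ × ℕ)) : State :=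
  if e = 0 then (0, k) else
  if e = 1 then (v + 1, k) else
  if e = 2 then (v.unpair.1, k) else
  if e = 3 then (v.unpair.2, k) else
  -- The index 4 is the oracle call, for which `step` does not use this function; the value given by
  -- truncated subtraction there is irrelevant.
  if (e - 5) % 4 = 0 then
    (v, (0, ((e - 5) / 4).unpair.1, 0) :: (1, ((e - 5) / 4).unpair.2, v) :: k) else
  if (e - 5) % 4 = 1 then
    (v, (0, ((e - 5) / 4).unpair.2, 0) :: (0, ((e - 5) / 4).unpair.1, 0) :: k) else
  if (e - 5) % 4 = 2 then
    if v.unpair.2 = 0 then (v.unpair.1, (0, ((e - 5) / 4).unpair.1, 0) :: k) else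
      (Nat.pair v.unpair.1 (v.unpair.2 - 1), (0, e, 0) ::
        (3, ((e - 5) / 4).unpair.2, Nat.pair v.unpair.1 (v.unpair.2 - 1)) :: k)
  else (v, (0, (e - 5) / 4, 0) :: (4, e, v) :: k)

/-- The step for an instruction `(t, e, d)` that does not call the oracle, at the value `v`. -/
def instrStep (t e d v : ℕ) (k : List (ℕ × ℕ × ℕ)) : State :=
  if t = 0 then evalStep e v k else
  -- Tags 1 and 2 finish a `pair`: run the second program on the saved input `d`, then pair the two
  -- values. Tag 3 feeds the previous value of a `prec` to its step program. Tag 4 inspects a value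
  -- tested by `rfind'`, and either stops or restarts the search at the next number.
  if t = 1 then (d, (0, e, 0) :: (2, 0, v) :: k) else
  if t = 2 then (Nat.pair d v, k) else
  if t = 3 then (Nat.pair d.unpair.1 (Nat.pair d.unpair.2 v), (0, e, 0) :: k) else
  if v = 0 then (d.unpair.2, k) else (Nat.pair d.unpair.1 (d.unpair.2 + 1), (0, e, 0) :: k)

/-- The number of instructions on the stack. -/
def size (s : State) : ℕ := s.2.length

/-- A step that does not call the oracle. -/
def next (s : State) : State :=
  if size s = 0 then s else
    instrStep s.2.headI.1 s.2.headI.2.1 s.2.headI.2.2 s.1 s.2.tail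

/-- The next step calls the oracle. -/
def IsQuery (s : State) : Prop := size s ≠ 0 ∧ s.2.headI.1 = 0 ∧ s.2.headI.2.1 = 4

instance : DecidablePred IsQuery := fun s => by unfold IsQuery; infer_instance

/-- Return `v` as the answer of the oracle. -/
def resume (s : State) (v : ℕ) : State := (v, s.2.tail)

variable (f : ℕ →. ℕ)

/-- A step of the machine. -/
def step (s : State) : Part State :=
  if IsQuery s then (f s.1).map (resume s) else Part.some (next s)

/-- Iterated steps. -/
def steps (s : State) : ℕ → Part State
  | 0 => Part.some s
  | j + 1 => (steps s j).bind (step f)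

theorem steps_succ' (s : State) (j : ℕ) :
    steps f s (j + 1) = (step f s).bind fun s' => steps f s' j := by
  induction j with
  | zero => simp [steps]
  | succ j ih => rw [steps, ih, Part.bind_assoc]; rfl

theorem steps_add (s : State) (i j : ℕ) :
    steps f s (i + j) = (steps f s i).bind fun s' => steps f s' j := by
  induction j with
  | zero => simp [steps]
  | succ j ih => rw [← Nat.add_assoc, steps, ih, Part.bind_assoc]; rfl

theorem step_nil (v : ℕ) : step f (v, []) = Part.some (v, []) := by
  simp [step, IsQuery, next, size]

theorem steps_nil (v j : ℕ) : steps f (v, []) j = Part.some (v, []) := by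
  induction j with
  | zero => rfl
  | succ j ih => rw [steps, ih, Part.bind_some, step_nil]

theorem step_cons {t e d v : ℕ} {k : List (ℕ × ℕ × ℕ)} (h : ¬ (t = 0 ∧ e = 4)) :
    step f (v, (t, e, d) :: k) = Part.some (instrStep t e d v k) := by
  simp [step, IsQuery, next, size, h]

theorem step_query {d v : ℕ} {k : List (ℕ × ℕ × ℕ)} :
    step f (v, (0, 4, d) :: k) = (f v).map fun x => (x, k) := by
  simp [step, IsQuery, size]
  rfl

variable {f}

/-! ### Correctness of the machine -/

theorem mem_eval_pair {p q : OracleCode} {v y : ℕ} : y ∈ eval f (pair p q) v ↔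
    ∃ a ∈ eval f p v, ∃ b ∈ eval f q v, y = Nat.pair a b := by
  simp [eval, Seq.seq, eq_comm]

theorem mem_eval_comp {p q : OracleCode} {v y : ℕ} : y ∈ eval f (comp p q) v ↔
    ∃ a ∈ eval f q v, y ∈ eval f p a :=
  Part.mem_bind_iff

theorem eval_prec_zero (p q : OracleCode) {v : ℕ} (h : v.unpair.2 = 0) :
    eval f (prec p q) v = eval f p v.unpair.1 := by
  simp [eval, Nat.unpaired, h]

theorem mem_eval_prec_succ {p q : OracleCode} {v n y : ℕ} (h : v.unpair.2 = n + 1) :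
    y ∈ eval f (prec p q) v ↔ ∃ i ∈ eval f (prec p q) (Nat.pair v.unpair.1 n),
      y ∈ eval f q (Nat.pair v.unpair.1 (Nat.pair n i)) := by
  simp [eval, Nat.unpaired, h]

theorem mem_eval_rfind' {p : OracleCode} {v y : ℕ} : y ∈ eval f (rfind' p) v ↔
    ∃ n, y = n + v.unpair.2 ∧ 0 ∈ eval f p (Nat.pair v.unpair.1 (n + v.unpair.2)) ∧
      ∀ i < n, ∃ r ∈ eval f p (Nat.pair v.unpair.1 (i + v.unpair.2)), r ≠ 0 := by
  simp only [eval, Nat.unpaired, Part.mem_map_iff, Part.map_eq_map, eq_comm (a := y)]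
  refine exists_congr fun n => ?_
  rw [and_comm]
  refine and_congr_right fun _ => Nat.mem_rfind.trans ?_
  simp

/-- The machine computes `s'` from `s`. -/
def Reaches (f : ℕ →. ℕ) (s s' : State) : Prop := ∃ j, s' ∈ steps f s j

theorem Reaches.refl (s : State) : Reaches f s s := ⟨0, Part.mem_some _⟩

theorem Reaches.trans {s s' s'' : State} (h : Reaches f s s') (h' : Reaches f s' s'') :
    Reaches f s s'' := by
  obtain ⟨i, hi⟩ := h
  obtain ⟨j, hj⟩ := h'
  exact ⟨i + j, by rw [steps_add]; exact Part.mem_bind hi hj⟩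

theorem Reaches.head {s s' s'' : State} (h : step f s = Part.some s') (h' : Reaches f s' s'') :
    Reaches f s s'' := by
  obtain ⟨j, hj⟩ := h'
  exact ⟨j + 1, by rwa [steps_succ', h, Part.bind_some]⟩

theorem evalStep_pair (a b v : ℕ) (k : List (ℕ × ℕ × ℕ)) :
    evalStep (4 * Nat.pair a b + 5) v k = (v, (0, a, 0) :: (1, b, v) :: k) := by
  simp [evalStep]

theorem evalStep_comp (a b v : ℕ) (k : List (ℕ × ℕ × ℕ)) :
    evalStep (4 * Nat.pair a b + 6) v k = (v, (0, b, 0) :: (0, a, 0) :: k) := by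
  have e0 : 4 * Nat.pair a b + 6 - 5 = 4 * Nat.pair a b + 1 := by omega
  have e1 : (4 * Nat.pair a b + 1) / 4 = Nat.pair a b := by omega
  have e2 : (4 * Nat.pair a b + 1) % 4 = 1 := by omega
  simp [evalStep, e0, e1, e2]

theorem evalStep_prec (a b v : ℕ) (k : List (ℕ × ℕ × ℕ)) :
    evalStep (4 * Nat.pair a b + 7) v k =
      if v.unpair.2 = 0 then (v.unpair.1, (0, a, 0) :: k) else
      (Nat.pair v.unpair.1 (v.unpair.2 - 1), (0, 4 * Nat.pair a b + 7, 0) ::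
        (3, b, Nat.pair v.unpair.1 (v.unpair.2 - 1)) :: k) := by
  have e0 : 4 * Nat.pair a b + 7 - 5 = 4 * Nat.pair a b + 2 := by omega
  have e1 : (4 * Nat.pair a b + 2) / 4 = Nat.pair a b := by omega
  have e2 : (4 * Nat.pair a b + 2) % 4 = 2 := by omega
  simp [evalStep, e0, e1, e2]

theorem evalStep_rfind' (a v : ℕ) (k : List (ℕ × ℕ × ℕ)) :
    evalStep (4 * a + 8) v k = (v, (0, a, 0) :: (4, 4 * a + 8, v) :: k) := by
  have e0 : 4 * a + 8 - 5 = 4 * a + 3 := by omega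
  have e1 : (4 * a + 3) / 4 = a := by omega
  have e2 : (4 * a + 3) % 4 = 3 := by omega
  simp [evalStep, e0, e1, e2]

theorem step_pair (a b d v : ℕ) (k : List (ℕ × ℕ × ℕ)) :
    step f (v, (0, 4 * Nat.pair a b + 5, d) :: k) =
      Part.some (v, (0, a, 0) :: (1, b, v) :: k) := by
  rw [step_cons _ (by omega), instrStep, if_pos rfl, evalStep_pair]

theorem step_comp (a b d v : ℕ) (k : List (ℕ × ℕ × ℕ)) :
    step f (v, (0, 4 * Nat.pair a b + 6, d) :: k) =
      Part.some (v, (0, b, 0) :: (0, a, 0) :: k) := by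
  rw [step_cons _ (by omega), instrStep, if_pos rfl, evalStep_comp]

theorem step_prec_zero (a b d : ℕ) {v : ℕ} (k : List (ℕ × ℕ × ℕ)) (h : v.unpair.2 = 0) :
    step f (v, (0, 4 * Nat.pair a b + 7, d) :: k) =
      Part.some (v.unpair.1, (0, a, 0) :: k) := by
  rw [step_cons _ (by omega), instrStep, if_pos rfl, evalStep_prec, if_pos h]

theorem step_prec_succ (a b d : ℕ) {v n : ℕ} (k : List (ℕ × ℕ × ℕ)) (h : v.unpair.2 = n + 1) :
    step f (v, (0, 4 * Nat.pair a b + 7, d) :: k) =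
      Part.some (Nat.pair v.unpair.1 n, (0, 4 * Nat.pair a b + 7, 0) ::
        (3, b, Nat.pair v.unpair.1 n) :: k) := by
  rw [step_cons _ (by omega), instrStep, if_pos rfl, evalStep_prec, if_neg (by omega), h,
    Nat.add_sub_cancel]

theorem step_rfind' (a d v : ℕ) (k : List (ℕ × ℕ × ℕ)) :
    step f (v, (0, 4 * a + 8, d) :: k) =
      Part.some (v, (0, a, 0) :: (4, 4 * a + 8, v) :: k) := by
  rw [step_cons _ (by omega), instrStep, if_pos rfl, evalStep_rfind']

theorem step_one (e d v : ℕ) (k : List (ℕ × ℕ × ℕ)) :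
    step f (v, (1, e, d) :: k) = Part.some (d, (0, e, 0) :: (2, 0, v) :: k) :=
  step_cons _ (by omega)

theorem step_two (e d v : ℕ) (k : List (ℕ × ℕ × ℕ)) :
    step f (v, (2, e, d) :: k) = Part.some (Nat.pair d v, k) :=
  step_cons _ (by omega)

theorem step_three (e a n v : ℕ) (k : List (ℕ × ℕ × ℕ)) :
    step f (v, (3, e, Nat.pair a n) :: k) =
      Part.some (Nat.pair a (Nat.pair n v), (0, e, 0) :: k) := by
  rw [step_cons _ (by omega)]
  simp [instrStep]

theorem step_four_zero (e d : ℕ) (k : List (ℕ × ℕ × ℕ)) :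
    step f (0, (4, e, d) :: k) = Part.some (d.unpair.2, k) := by
  rw [step_cons _ (by omega)]
  simp [instrStep]

theorem step_four_succ (e d : ℕ) {v : ℕ} (k : List (ℕ × ℕ × ℕ)) (hv : v ≠ 0) :
    step f (v, (4, e, d) :: k) =
      Part.some (Nat.pair d.unpair.1 (d.unpair.2 + 1), (0, e, 0) :: k) := by
  rw [step_cons _ (by omega)]
  simp [instrStep, hv]

/-- Induction on the index. Since `prec` and `rfind'` push their own index again, these two cases
need an inner induction on the recursion argument and on the length of the search. -/
theorem reaches_of_mem_eval (e : ℕ) : ∀ {v y : ℕ}, y ∈ eval f (decode e) v →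
    ∀ d k, Reaches f (v, (0, e, d) :: k) (y, k) := by
  induction e using Nat.strong_induction_on with
  | _ e ih =>
  intro v y hy d k
  rcases index_cases e with rfl | rfl | rfl | rfl | rfl | ⟨a, b, ha, hb, rfl | rfl | rfl⟩ |
    ⟨a, rfl⟩
  iterate 4
    · simp only [decode, eval, Part.mem_some_iff] at hy
      subst hy
      exact .head (step_cons _ (by omega)) (.refl _)
  · exact ⟨1, by simpa [steps, step_query, decode, eval] using hy⟩
  · rw [decode_pair, mem_eval_pair] at hy
    obtain ⟨x, hx, z, hz, rfl⟩ := hy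
    refine .head (step_pair ..) ((ih a ha hx _ _).trans ?_)
    exact .head (step_one ..) ((ih b hb hz _ _).trans (.head (step_two ..) (.refl _)))
  · rw [decode_comp, mem_eval_comp] at hy
    obtain ⟨x, hx, hy⟩ := hy
    exact .head (step_comp ..) ((ih b hb hx _ _).trans (ih a ha hy _ _))
  · rw [decode_prec] at hy
    generalize hn : v.unpair.2 = n
    induction n generalizing v y d k with
    | zero =>
      rw [eval_prec_zero _ _ hn] at hy
      exact .head (step_prec_zero _ _ _ _ hn) (ih a ha hy _ _)
    | succ n ihn =>
      obtain ⟨i, hi, hy⟩ := (mem_eval_prec_succ hn).1 hy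
      refine .head (step_prec_succ _ _ _ _ hn) ((ihn _ _ hi (by simp)).trans ?_)
      exact .head (step_three ..) (ih b hb hy _ _)
  · rw [decode_rfind', mem_eval_rfind'] at hy
    obtain ⟨n, rfl, hn, hlt⟩ := hy
    induction n generalizing v d k with
    | zero =>
      rw [Nat.zero_add, Nat.pair_unpair] at hn
      refine .head (step_rfind' ..) ((ih a (by omega) hn _ _).trans ?_)
      rw [Nat.zero_add]
      exact .head (step_four_zero ..) (.refl _)
    | succ n ihn =>
      obtain ⟨r, hr, hr0⟩ := hlt 0 (by omega)
      rw [Nat.zero_add, Nat.pair_unpair] at hr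
      refine .head (step_rfind' ..) ((ih a (by omega) hr _ _).trans
        (.head (step_four_succ _ _ _ hr0) ?_))
      -- After a nonzero value the search is the same search with its starting point raised by one.
      have h1 := ihn (v := Nat.pair v.unpair.1 (v.unpair.2 + 1)) 0 k
        (by simpa [add_assoc, add_comm 1] using hn)
        (fun i hi => by simpa [add_assoc, add_comm 1] using hlt (i + 1) (by omega))
      simpa [add_assoc, add_comm 1] using h1

/-- A halting run must pop the instruction, and so passes through a state `(y, k)`. The induction is
on the number of steps, not on `e`, because the machine may execute the same index again; the bound
`i < j` makes successive appeals to the hypothesis possible. -/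
theorem mem_eval_of_steps (j : ℕ) : ∀ {e v d w : ℕ} {k : List (ℕ × ℕ × ℕ)},
    (w, []) ∈ steps f (v, (0, e, d) :: k) j →
    ∃ y ∈ eval f (decode e) v, ∃ i < j, (w, []) ∈ steps f (y, k) i := by
  induction j using Nat.strong_induction_on with
  | _ j ih =>
  have peel {s s' : State} {w j : ℕ} (hs : step f s = Part.some s') (hne : s.2 ≠ [])
      (h : (w, []) ∈ steps f s j) : ∃ i < j, (w, []) ∈ steps f s' i := by
    cases j with
    | zero =>
      rw [steps, Part.mem_some_iff] at h
      exact absurd (congrArg Prod.snd h).symm hne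
    | succ j =>
      rw [steps_succ', hs, Part.bind_some] at h
      exact ⟨j, by omega, h⟩
  intro e v d w k h
  rcases index_cases e with rfl | rfl | rfl | rfl | rfl | ⟨a, b, ha, hb, rfl | rfl | rfl⟩ |
    ⟨a, rfl⟩
  iterate 4
    · obtain ⟨i, hi, h⟩ := peel (step_cons f (by omega)) (by simp) h
      exact ⟨_, by simp only [decode, eval]; exact Part.mem_some _, i, hi, h⟩
  · cases j with
    | zero => simp [steps] at h
    | succ j =>
      rw [steps_succ', step_query] at h
      obtain ⟨s, hs, h⟩ := Part.mem_bind_iff.1 h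
      obtain ⟨y, hy, rfl⟩ := (Part.mem_map_iff _).1 hs
      exact ⟨y, by simpa [decode, eval] using hy, j, by omega, h⟩
  · obtain ⟨i₁, h₁, h⟩ := peel (step_pair ..) (by simp) h
    obtain ⟨x, hx, i₂, h₂, h⟩ := ih i₁ h₁ h
    obtain ⟨i₃, h₃, h⟩ := peel (step_one ..) (by simp) h
    obtain ⟨z, hz, i₄, h₄, h⟩ := ih i₃ (by omega) h
    obtain ⟨i₅, h₅, h⟩ := peel (step_two ..) (by simp) h
    exact ⟨_, by rw [decode_pair]; exact mem_eval_pair.2 ⟨x, hx, z, hz, rfl⟩, i₅, by omega, h⟩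
  · obtain ⟨i₁, h₁, h⟩ := peel (step_comp ..) (by simp) h
    obtain ⟨x, hx, i₂, h₂, h⟩ := ih i₁ h₁ h
    obtain ⟨z, hz, i₄, h₄, h⟩ := ih i₂ (by omega) h
    exact ⟨z, by rw [decode_comp]; exact mem_eval_comp.2 ⟨x, hx, hz⟩, i₄, by omega, h⟩
  · rw [decode_prec]
    rcases hn : v.unpair.2 with _ | n
    · obtain ⟨i₁, h₁, h⟩ := peel (step_prec_zero _ _ _ _ hn) (by simp) h
      obtain ⟨x, hx, i₂, h₂, h⟩ := ih i₁ h₁ h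
      exact ⟨x, by rwa [eval_prec_zero _ _ hn], i₂, by omega, h⟩
    · obtain ⟨i₁, h₁, h⟩ := peel (step_prec_succ _ _ _ _ hn) (by simp) h
      obtain ⟨x, hx, i₂, h₂, h⟩ := ih i₁ h₁ h
      obtain ⟨i₃, h₃, h⟩ := peel (step_three ..) (by simp) h
      obtain ⟨z, hz, i₄, h₄, h⟩ := ih i₃ (by omega) h
      rw [decode_prec] at hx
      exact ⟨z, (mem_eval_prec_succ hn).2 ⟨x, hx, hz⟩, i₄, by omega, h⟩
  · obtain ⟨i₁, h₁, h⟩ := peel (step_rfind' ..) (by simp) h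
    obtain ⟨x, hx, i₂, h₂, h⟩ := ih i₁ h₁ h
    rw [decode_rfind']
    rcases eq_or_ne x 0 with rfl | hx0
    · obtain ⟨i₃, h₃, h⟩ := peel (step_four_zero ..) (by simp) h
      exact ⟨_, mem_eval_rfind'.2 ⟨0, (Nat.zero_add _).symm, by simpa using hx, by simp⟩, i₃,
        by omega, h⟩
    · obtain ⟨i₃, h₃, h⟩ := peel (step_four_succ _ _ _ hx0) (by simp) h
      obtain ⟨z, hz, i₄, h₄, h⟩ := ih i₃ (by omega) h
      rw [decode_rfind', mem_eval_rfind'] at hz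
      obtain ⟨n, rfl, hn, hlt⟩ := hz
      simp only [Nat.unpair_pair] at hn hlt h
      refine ⟨_, mem_eval_rfind'.2 ⟨n + 1, rfl, ?_, fun i hi => ?_⟩, i₄, by omega, ?_⟩
      · simpa [add_assoc, add_comm 1] using hn
      · rcases i with _ | i
        · exact ⟨x, by simpa using hx, hx0⟩
        · simpa [add_assoc, add_comm 1] using hlt i (by omega)
      · simpa [add_assoc, add_comm 1] using h

theorem reaches_iff {e v w d : ℕ} :
    Reaches f (v, [(0, e, d)]) (w, []) ↔ w ∈ eval f (decode e) v := by
  constructor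
  · rintro ⟨j, hj⟩
    obtain ⟨y, hy, i, -, hi⟩ := mem_eval_of_steps j hj
    rw [steps_nil, Part.mem_some_iff] at hi
    cases hi
    exact hy
  · exact fun h => reaches_of_mem_eval e h _ _

end OracleCode

namespace OracleCode

/-! ### The universal program -/

theorem primrec_evalStep : Primrec fun p : ℕ × ℕ × List (ℕ × ℕ × ℕ) =>
    evalStep p.1 p.2.1 p.2.2 := by
  have he : Primrec fun p : ℕ × ℕ × List (ℕ × ℕ × ℕ) => p.1 := .fst
  have hv : Primrec fun p : ℕ × ℕ × List (ℕ × ℕ × ℕ) => p.2.1 := Primrec.fst.comp .snd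
  have hk : Primrec fun p : ℕ × ℕ × List (ℕ × ℕ × ℕ) => p.2.2 := Primrec.snd.comp .snd
  have hq := Primrec.nat_div.comp (Primrec.nat_sub.comp he (.const 5)) (.const 4)
  have hm := Primrec.nat_mod.comp (Primrec.nat_sub.comp he (.const 5)) (.const 4)
  have hq₁ := Primrec.fst.comp (Primrec.unpair.comp hq)
  have hq₂ := Primrec.snd.comp (Primrec.unpair.comp hq)
  have hv₁ := Primrec.fst.comp (Primrec.unpair.comp hv)
  have hv₂ := Primrec.snd.comp (Primrec.unpair.comp hv)
  have hp := Primrec₂.natPair.comp hv₁ (Primrec.nat_sub.comp hv₂ (.const 1))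
  have instr (t : ℕ) {g h : ℕ × ℕ × List (ℕ × ℕ × ℕ) → ℕ} (hg : Primrec g) (hh : Primrec h)
      {l : ℕ × ℕ × List (ℕ × ℕ × ℕ) → List (ℕ × ℕ × ℕ)} (hl : Primrec l) :
      Primrec fun p => (t, g p, h p) :: l p :=
    Primrec.list_cons.comp ((Primrec.const t).pair (hg.pair hh)) hl
  have is {g : ℕ × ℕ × List (ℕ × ℕ × ℕ) → ℕ} (hg : Primrec g) (n : ℕ) :
      PrimrecPred fun p => g p = n := Primrec.eq.comp hg (.const n)
  have h0 : Primrec fun _ : ℕ × ℕ × List (ℕ × ℕ × ℕ) => 0 := .const 0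
  exact .ite (is he 0) (h0.pair hk) <|
    .ite (is he 1) ((Primrec.succ.comp hv).pair hk) <|
    .ite (is he 2) (hv₁.pair hk) <|
    .ite (is he 3) (hv₂.pair hk) <|
    .ite (is hm 0) (hv.pair (instr 0 hq₁ h0 (instr 1 hq₂ hv hk))) <|
    .ite (is hm 1) (hv.pair (instr 0 hq₂ h0 (instr 0 hq₁ h0 hk))) <|
    .ite (is hm 2) (.ite (is hv₂ 0) (hv₁.pair (instr 0 hq₁ h0 hk))
      (hp.pair (instr 0 he h0 (instr 3 hq₂ hp hk)))) <|
    hv.pair (instr 0 hq h0 (instr 4 he hv hk))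

theorem primrec_instrStep : Primrec fun p : (ℕ × ℕ × ℕ) × ℕ × List (ℕ × ℕ × ℕ) =>
    instrStep p.1.1 p.1.2.1 p.1.2.2 p.2.1 p.2.2 := by
  have ht : Primrec fun p : (ℕ × ℕ × ℕ) × ℕ × List (ℕ × ℕ × ℕ) => p.1.1 := Primrec.fst.comp .fst
  have hed : Primrec fun p : (ℕ × ℕ × ℕ) × ℕ × List (ℕ × ℕ × ℕ) => p.1.2 := Primrec.snd.comp .fst
  have he := Primrec.fst.comp hed
  have hd := Primrec.snd.comp hed
  have hv : Primrec fun p : (ℕ × ℕ × ℕ) × ℕ × List (ℕ × ℕ × ℕ) => p.2.1 := Primrec.fst.comp .snd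
  have hk : Primrec fun p : (ℕ × ℕ × ℕ) × ℕ × List (ℕ × ℕ × ℕ) => p.2.2 := Primrec.snd.comp .snd
  have hd₁ := Primrec.fst.comp (Primrec.unpair.comp hd)
  have hd₂ := Primrec.snd.comp (Primrec.unpair.comp hd)
  have instr (t : ℕ) {g h : (ℕ × ℕ × ℕ) × ℕ × List (ℕ × ℕ × ℕ) → ℕ} (hg : Primrec g)
      (hh : Primrec h) {l : (ℕ × ℕ × ℕ) × ℕ × List (ℕ × ℕ × ℕ) → List (ℕ × ℕ × ℕ)}
      (hl : Primrec l) : Primrec fun p => (t, g p, h p) :: l p :=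
    Primrec.list_cons.comp ((Primrec.const t).pair (hg.pair hh)) hl
  have is {g : (ℕ × ℕ × ℕ) × ℕ × List (ℕ × ℕ × ℕ) → ℕ} (hg : Primrec g) (n : ℕ) :
      PrimrecPred fun p => g p = n := Primrec.eq.comp hg (.const n)
  have h0 : Primrec fun _ : (ℕ × ℕ × ℕ) × ℕ × List (ℕ × ℕ × ℕ) => 0 := .const 0
  exact .ite (is ht 0) (primrec_evalStep.comp (he.pair (hv.pair hk))) <|
    .ite (is ht 1) (hd.pair (instr 0 he h0 (instr 2 h0 hv hk))) <|
    .ite (is ht 2) ((Primrec₂.natPair.comp hd hv).pair hk) <|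
    .ite (is ht 3) ((Primrec₂.natPair.comp hd₁ (Primrec₂.natPair.comp hd₂ hv)).pair
      (instr 0 he h0 hk)) <|
    .ite (is hv 0) (hd₂.pair hk)
      ((Primrec₂.natPair.comp hd₁ (Primrec.succ.comp hd₂)).pair (instr 0 he h0 hk))

theorem primrec_size : Primrec size := Primrec.list_length.comp .snd

theorem primrec_next : Primrec next := by
  have hk : Primrec fun s : State => s.2 := .snd
  exact .ite (Primrec.eq.comp primrec_size (.const 0)) .id
    (primrec_instrStep.comp ((Primrec.list_headI.comp hk).pair
      (Primrec.fst.pair (Primrec.list_tail.comp hk))))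

theorem primrecPred_isQuery : PrimrecPred IsQuery := by
  have hk : Primrec fun s : State => s.2 := .snd
  have hi := Primrec.list_headI.comp hk
  exact (Primrec.eq.comp primrec_size (.const 0)).not.and
    ((Primrec.eq.comp (Primrec.fst.comp hi) (.const 0)).and
      (Primrec.eq.comp (Primrec.fst.comp (Primrec.snd.comp hi)) (.const 4)))

theorem primrec₂_resume : Primrec₂ resume :=
  Primrec.pair .snd (Primrec.list_tail.comp (Primrec.snd.comp .fst))

variable (f : ℕ →. ℕ)

theorem eval_comp_of_eq {p q : OracleCode} {n a : ℕ} (h : eval f q n = Part.some a) :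
    eval f (comp p q) n = eval f p a := by
  change (eval f q n).bind (eval f p) = _
  rw [h]
  exact Part.bind_some _ _

theorem eval_pair_of_eq {p q : OracleCode} {n a b : ℕ} (hp : eval f p n = Part.some a)
    (hq : eval f q n = Part.some b) : eval f (pair p q) n = Part.some (Nat.pair a b) := by
  simp [eval, Seq.seq, hp, hq]

theorem eval_id (n : ℕ) : eval f (pair left right) n = Part.some n := by
  rw [eval_pair_of_eq f (a := n.unpair.1) (b := n.unpair.2) (by rw [eval]) (by rw [eval]),
    Nat.pair_unpair]

theorem eval_left_pair (a b : ℕ) : eval f left (Nat.pair a b) = Part.some a := by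
  simp [eval]

theorem eval_right_pair (a b : ℕ) : eval f right (Nat.pair a b) = Part.some b := by
  simp [eval]

/-- A program without oracle calls. -/
def ofCode : Nat.Partrec.Code → OracleCode
  | .zero => zero
  | .succ => succ
  | .left => left
  | .right => right
  | .pair p q => pair (ofCode p) (ofCode q)
  | .comp p q => comp (ofCode p) (ofCode q)
  | .prec p q => prec (ofCode p) (ofCode q)
  | .rfind' p => rfind' (ofCode p)

theorem eval_ofCode (c : Nat.Partrec.Code) : eval f (ofCode c) = c.eval := by
  induction c with
  | zero | succ | left | right => rfl
  | pair p q hp hq | comp p q hp hq | prec p q hp hq =>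
    simp only [ofCode, eval, Nat.Partrec.Code.eval, hp, hq]
    try rfl
  | rfind' p hp =>
    simp only [ofCode, eval, Nat.Partrec.Code.eval, hp]
    try rfl

theorem exists_of_partrec {g : ℕ →. ℕ} (hg : Partrec g) : ∃ p, ∀ f, eval f p = g := by
  obtain ⟨c, rfl⟩ := Nat.Partrec.Code.exists_code.1 (Partrec.nat_iff.1 hg)
  exact ⟨ofCode c, fun f => eval_ofCode f c⟩

theorem exists_of_primrec {g : State → ℕ} (hg : Primrec g) :
    ∃ p, ∀ f s, eval f p (Encodable.encode s) = Part.some (g s) := by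
  obtain ⟨p, hp⟩ := exists_of_partrec (hg.comp (Primrec.ofNat State)).to_comp.partrec
  refine ⟨p, fun f s => ?_⟩
  rw [hp]
  exact congrArg (fun s => Part.some (g s)) (Denumerable.ofNat_encode s)

/-- Primitive recursion on a 0–1 flag acts as a conditional: the oracle is called only if the flag
is 1. This matters because a call outside the domain of `f` would make an ordinary step diverge. -/
theorem exists_step : ∃ p, ∀ s : State,
    eval f p (Encodable.encode s) = (step f s).map Encodable.encode := by
  obtain ⟨pn, hpn⟩ := exists_of_primrec (Primrec.encode.comp primrec_next)
  obtain ⟨pq, hpq⟩ := exists_of_primrec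
    (.ite primrecPred_isQuery (.const 1) (.const 0) : Primrec fun s => if IsQuery s then 1 else 0)
  obtain ⟨pa, hpa⟩ := exists_of_primrec (Primrec.fst (α := ℕ) (β := List (ℕ × ℕ × ℕ)))
  obtain ⟨pr, hpr⟩ := exists_of_partrec (Primrec.encode.comp (primrec₂_resume.comp
    ((Primrec.ofNat State).comp (Primrec.fst.comp Primrec.unpair))
    (Primrec.snd.comp Primrec.unpair))).to_comp.partrec
  refine ⟨comp (prec pn (comp pr (pair left (comp oracle (comp pa left)))))
    (pair (pair left right) pq), fun s => ?_⟩
  rw [eval_comp_of_eq f (eval_pair_of_eq f (eval_id f _) (hpq f s)), step]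
  split_ifs with h
  · have h1 (i : ℕ) : eval f (comp oracle (comp pa left))
        (Nat.pair (Encodable.encode s) i) = f s.1 := by
      rw [eval_comp_of_eq f (a := s.1), eval]
      rw [eval_comp_of_eq f (eval_left_pair f _ _), hpa]
    have h2 (v : ℕ) : eval f pr (Nat.pair (Encodable.encode s) v) =
        Part.some (Encodable.encode (resume s v)) := by
      rw [hpr, PFun.coe_val, Nat.unpair_pair, Denumerable.ofNat_encode]
    ext y
    rw [mem_eval_prec_succ (n := 0) (by simp), Nat.unpair_pair,
      eval_prec_zero _ _ (by simp), Nat.unpair_pair, hpn]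
    simp only [Part.mem_some_iff, exists_eq_left, mem_eval_comp, mem_eval_pair, h1,
      eval_left_pair, Part.mem_map_iff]
    constructor
    · rintro ⟨_, ⟨v, hv, rfl⟩, hy⟩
      rw [h2, Part.mem_some_iff] at hy
      exact ⟨_, ⟨v, hv, rfl⟩, hy.symm⟩
    · rintro ⟨_, ⟨v, hv, rfl⟩, rfl⟩
      exact ⟨_, ⟨v, hv, rfl⟩, by rw [h2]; exact Part.mem_some _⟩
  · rw [eval_prec_zero _ _ (by simp), Nat.unpair_pair, hpn, Part.map_some]

theorem exists_steps : ∃ p, ∀ (s : State) (j : ℕ),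
    eval f p (Nat.pair (Encodable.encode s) j) = (steps f s j).map Encodable.encode := by
  obtain ⟨p, hp⟩ := exists_step f
  refine ⟨prec (pair left right) (comp p (comp right right)), fun s j => ?_⟩
  induction j with
  | zero => rw [eval_prec_zero _ _ (by simp), eval_id, steps, Nat.unpair_pair, Part.map_some]
  | succ j ih =>
    ext y
    rw [mem_eval_prec_succ (n := j) (by simp)]
    simp only [Nat.unpair_pair, ih]
    have h1 (a b i : ℕ) : eval f (comp p (comp right right)) (Nat.pair a (Nat.pair b i)) =
        eval f p i := by
      rw [eval_comp_of_eq f (a := i)]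
      rw [eval_comp_of_eq f (eval_right_pair f _ _), eval_right_pair]
    simp only [h1, steps, Part.mem_map_iff, Part.mem_bind_iff]
    constructor
    · rintro ⟨_, ⟨s', hs', rfl⟩, h⟩
      rw [hp, Part.mem_map_iff] at h
      obtain ⟨s'', hs'', rfl⟩ := h
      exact ⟨s'', ⟨s', hs', hs''⟩, rfl⟩
    · rintro ⟨s'', ⟨s', hs', hs''⟩, rfl⟩
      exact ⟨_, ⟨s', hs', rfl⟩, by rw [hp]; exact Part.mem_map _ hs''⟩

/-- Normal form: `rfind'` searches for the number of steps after which the stack is empty, and the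
value at that stage is the result. -/
theorem exists_universal : ∃ p, ∀ e v,
    eval f p (Nat.pair e v) = eval f (decode e) v := by
  obtain ⟨pj, hpj⟩ := exists_steps f
  obtain ⟨ph, hph⟩ := exists_of_primrec primrec_size
  obtain ⟨po, hpo⟩ := exists_of_primrec (Primrec.fst (α := ℕ) (β := List (ℕ × ℕ × ℕ)))
  obtain ⟨pi, hpi⟩ : ∃ p, ∀ e v, eval f p (Nat.pair e v) =
      Part.some (Encodable.encode (α := State) (v, [(0, e, 0)])) := by
    have h : Primrec fun t : ℕ =>
        Encodable.encode (α := State) (t.unpair.2, [(0, t.unpair.1, 0)]) :=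
      Primrec.encode.comp ((Primrec.snd.comp Primrec.unpair).pair
        (Primrec.list_cons.comp ((Primrec.const 0).pair
          ((Primrec.fst.comp Primrec.unpair).pair (.const 0))) (.const [])))
    obtain ⟨p, hp⟩ := exists_of_partrec h.to_comp.partrec
    exact ⟨p, fun e v => by simp [hp]⟩
  refine ⟨comp (comp po pj) (pair pi (comp (rfind' (comp ph pj)) (pair pi zero))),
    fun e v => ?_⟩
  have hmem {p : OracleCode} {g : State → ℕ}
      (hp : ∀ s, eval f p (Encodable.encode s) = Part.some (g s)) (s : State) (j r : ℕ) :
      r ∈ eval f (comp p pj) (Nat.pair (Encodable.encode s) j) ↔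
        ∃ s' ∈ steps f s j, g s' = r := by
    rw [mem_eval_comp, hpj]
    constructor
    · rintro ⟨_, h, hr⟩
      obtain ⟨s', hs', rfl⟩ := (Part.mem_map_iff _).1 h
      exact ⟨s', hs', by rw [hp, Part.mem_some_iff] at hr; exact hr.symm⟩
    · rintro ⟨s', hs', rfl⟩
      exact ⟨_, Part.mem_map _ hs', by rw [hp]; exact Part.mem_some _⟩
  have hs := hpi e v
  ext y
  rw [← reaches_iff (d := 0), mem_eval_comp]
  generalize (⟨v, [(0, e, 0)]⟩ : State) = s at hs ⊢
  have hr : eval f (comp (rfind' (comp ph pj)) (pair pi zero)) (Nat.pair e v) =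
      eval f (rfind' (comp ph pj)) (Nat.pair (Encodable.encode s) 0) :=
    eval_comp_of_eq f (eval_pair_of_eq f hs rfl)
  have hsize {t : State} (ht : size t = 0) : t = (t.1, []) :=
    Prod.ext rfl (List.length_eq_zero_iff.1 ht)
  simp only [mem_eval_pair, hr, hs, Part.mem_some_iff, exists_eq_left, mem_eval_rfind',
    hmem (hph f), Nat.unpair_pair, Nat.add_zero]
  constructor
  · rintro ⟨_, ⟨j, ⟨_, rfl, ⟨t, ht, ht0⟩, -⟩, rfl⟩, hy⟩
    obtain ⟨t', ht', rfl⟩ := (hmem (hpo f) _ _ _).1 hy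
    rw [Part.mem_unique ht' ht]
    exact ⟨j, by rwa [← hsize ht0]⟩
  · rintro ⟨j, hj⟩
    classical
    have hex : ∃ n, ∃ t ∈ steps f s n, size t = 0 := ⟨j, _, hj, rfl⟩
    obtain ⟨t, ht, ht0⟩ := Nat.find_spec hex
    have hle : Nat.find hex ≤ j := Nat.find_min' hex ⟨_, hj, rfl⟩
    -- The search needs a value at every earlier stage, which exists because the run is defined up
    -- to `j`. Halted states do not change, so the first halting stage has the same output as stage
    -- `j`.
    refine ⟨_, ⟨_, ⟨Nat.find hex, rfl, ⟨t, ht, ht0⟩, fun i hi => ?_⟩, rfl⟩, ?_⟩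
    · obtain ⟨k, rfl⟩ := Nat.exists_eq_add_of_le (hi.le.trans hle)
      rw [steps_add] at hj
      obtain ⟨t', ht', -⟩ := Part.mem_bind_iff.1 hj
      exact ⟨_, ⟨t', ht', rfl⟩, fun h => Nat.find_min hex hi ⟨t', ht', h⟩⟩
    · refine (hmem (hpo f) _ _ _).2 ⟨t, ht, ?_⟩
      obtain ⟨k, hk⟩ := Nat.exists_eq_add_of_le hle
      rw [hk, steps_add, Part.eq_some_iff.2 ht, Part.bind_some, hsize ht0, steps_nil,
        Part.mem_some_iff] at hj
      exact (congrArg Prod.fst hj).symm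

end OracleCode

open OracleCode

/-! ### Kleene's first model with an oracle -/

theorem kleeneOracle_encode (f : ℕ →. ℕ) (p : OracleCode) (n : ℕ) :
    kleeneOracle f p.encode n = p.eval f n := by
  rw [kleeneOracle, decode_encode]

/-- An index of the constant function with value `n`. -/
def constIndex (n : ℕ) : ℕ := n.rec 0 fun _ i => 4 * Nat.pair 1 i + 6

/-- The index `4 * Nat.pair 1 i + 6` composes `succ`, whose index is 1, with the program `i`. -/
theorem eval_constIndex (f : ℕ →. ℕ) (n a : ℕ) :
    (decode (constIndex n)).eval f a = Part.some n := by
  induction n with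
  | zero => simp [constIndex, decode, eval]
  | succ n ih =>
    change (decode (4 * Nat.pair 1 (constIndex n) + 6)).eval f a = _
    rw [decode_comp, eval_comp_of_eq f ih, decode, eval]

/-- The index of the partial function computed by `e` when its first argument is `a`. -/
def oracleCurry (e a : ℕ) : ℕ :=
  4 * Nat.pair e (4 * Nat.pair (constIndex a) (OracleCode.pair left right).encode + 5) + 6

theorem oracleCurry_app (f : ℕ →. ℕ) (e a b : ℕ) :
    kleeneOracle f (oracleCurry e a) b = kleeneOracle f e (Nat.pair a b) := by
  rw [kleeneOracle, oracleCurry, OracleCode.decode_comp, OracleCode.decode_pair, decode_encode,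
    eval_comp_of_eq f (eval_pair_of_eq f (eval_constIndex f a b) (eval_id f b))]
  rfl

theorem computable₂_oracleCurry : Computable₂ oracleCurry := by
  have hc : Primrec constIndex := Primrec.nat_rec₁ 0
    (Primrec.nat_add.comp (Primrec.nat_mul.comp (.const 4)
      (Primrec₂.natPair.comp (.const 1) .snd)) (.const 6))
  have hpair (k : ℕ) {g h : ℕ × ℕ → ℕ} (hg : Primrec g) (hh : Primrec h) :
      Primrec fun p => 4 * Nat.pair (g p) (h p) + k :=
    Primrec.nat_add.comp (Primrec.nat_mul.comp (.const 4) (Primrec₂.natPair.comp hg hh)) (.const k)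
  exact (hpair 6 .fst (hpair 5 (hc.comp .snd) (.const _))).to_comp

theorem kleeneOracle_isPCA (f : ℕ →. ℕ) : IsPCA (kleeneOracle f) := by
  refine isPCA_of_universal computable₂_oracleCurry (oracleCurry_app f) (fun g hg => ?_) ?_
  · obtain ⟨p, hp⟩ := exists_of_partrec hg.partrec
    exact ⟨p.encode, fun a => by rw [kleeneOracle_encode, hp]; rfl⟩
  · obtain ⟨p, hp⟩ := exists_universal f
    let p₁ : OracleCode := comp p (OracleCode.pair (comp left left) right)
    let p₂ : OracleCode := comp p (OracleCode.pair (comp right left) right)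
    refine ⟨(comp p (OracleCode.pair p₁ p₂)).encode, fun a b z => ?_⟩
    have h₁ : p₁.eval f (Nat.pair (Nat.pair a b) z) = kleeneOracle f a z := by
      rw [eval_comp_of_eq f (a := Nat.pair a z), hp]
      · rfl
      · refine eval_pair_of_eq f ?_ (eval_right_pair f _ _)
        rw [eval_comp_of_eq f (eval_left_pair f _ _), eval_left_pair]
    have h₂ : p₂.eval f (Nat.pair (Nat.pair a b) z) = kleeneOracle f b z := by
      rw [eval_comp_of_eq f (a := Nat.pair b z), hp]
      · rfl
      · refine eval_pair_of_eq f ?_ (eval_right_pair f _ _)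
        rw [eval_comp_of_eq f (eval_left_pair f _ _), eval_right_pair]
    ext y
    rw [kleeneOracle_encode, mem_eval_comp, PartialApp.mem_ap]
    simp only [mem_eval_pair, h₁, h₂]
    constructor
    · rintro ⟨_, ⟨x, hx, w, hw, rfl⟩, hy⟩
      exact ⟨x, hx, w, hw, by rwa [hp] at hy⟩
    · rintro ⟨x, hx, w, hw, hy⟩
      exact ⟨_, ⟨x, hx, w, hw, rfl⟩, by rwa [hp]⟩

theorem kleene_le_kleeneOracle (f : ℕ →. ℕ) : Le kleene (kleeneOracle f) := by
  obtain ⟨p, hp⟩ := exists_of_partrec (Partrec₂.unpaired.2 partrec₂_kleene)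
  obtain ⟨q, hq⟩ := exists_of_partrec
    (computable₂_oracleCurry.comp (Computable.const p.encode) Computable.id).partrec
  refine ⟨q.encode, fun a b x hx => ?_⟩
  rw [kleeneOracle_encode, hq, PFun.coe_val, PartialApp.ap_some_some, oracleCurry_app,
    kleeneOracle_encode, hp]
  simpa using hx

/-- The machine is run inside `n`: the primitive recursive operations on states come from `𝒦₁`
through `r`, and queries are answered by `φ`. -/
theorem kleeneOracle_le {f : ℕ →. ℕ} {n : PartialApp ℕ} (d : Combinators n) (h : Le kleene n)
    (hf : Representable n f) : Le (kleeneOracle f) n := by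
  obtain ⟨r, hr⟩ := h
  obtain ⟨φ, hφ⟩ := representable_iff.1 hf
  have h₁ {g : State → ℕ} (hg : Primrec g) : ∃ e, ∀ s, n.ap (n.ap (Part.some r) (Part.some e))
      (Part.some (Encodable.encode s)) = Part.some (g s) := by
    obtain ⟨e, he⟩ := exists_kleene (hg.comp (Primrec.ofNat State)).to_comp.partrec
    refine ⟨e, fun s => ap_of_realizer hr ?_⟩
    rw [kleene.ap_some_some, he]
    exact congrArg (fun s => Part.some (g s)) (Denumerable.ofNat_encode s)
  have h₂ {G : ℕ → ℕ → ℕ} (hG : Primrec₂ G) : ∃ e, ∀ a b, n.ap (n.ap (Part.some r)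
      (n.ap (n.ap (Part.some r) (Part.some e)) (Part.some a))) (Part.some b) =
        Part.some (G a b) := by
    obtain ⟨e, he⟩ := exists_kleene (hG.comp (Primrec.fst.comp Primrec.unpair)
      (Primrec.snd.comp Primrec.unpair)).to_comp.partrec
    obtain ⟨e', he'⟩ := exists_kleene
      (computable₂_kleeneCurry.comp (Computable.const e) Computable.id).partrec
    refine ⟨e', fun a b => ap_of_realizer₂ hr ?_⟩
    rw [kleene.ap_some_some, he', PFun.coe_val, kleene.ap_some_some, kleeneCurry_app, he]
    simp
  -- The Booleans of `n` are numbers, so the tests can output them directly and no conversion is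
  -- needed.
  obtain ⟨eh, heh⟩ := h₁ (.ite (Primrec.eq.comp primrec_size (.const 0)) (.const d.tt)
    (.const d.ff) : Primrec fun s => if size s = 0 then d.tt else d.ff)
  obtain ⟨eq, heq⟩ := h₁ (.ite primrecPred_isQuery (.const d.tt)
    (.const d.ff) : Primrec fun s => if IsQuery s then d.tt else d.ff)
  obtain ⟨eo, heo⟩ := h₁ (Primrec.fst (α := ℕ) (β := List (ℕ × ℕ × ℕ)))
  obtain ⟨en, hen⟩ := h₁ (Primrec.encode.comp primrec_next)
  obtain ⟨er, her⟩ := h₂ (G := fun a b => Encodable.encode (resume (Denumerable.ofNat State a) b))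
    (Primrec.encode.comp (primrec₂_resume.comp ((Primrec.ofNat State).comp .fst) .snd))
  obtain ⟨ei, hei⟩ := h₂ (G := fun a b => Encodable.encode (α := State) (b, [(0, a, 0)]))
    (Primrec.encode.comp (.pair .snd (Primrec.list_cons.comp
      (.pair (.const 0) (.pair .fst (.const 0))) (.const []))))
  let R : Term ℕ → Term ℕ → Term ℕ := fun t s => .const r ⬝ t ⬝ s
  let body : Term ℕ := d.ite (R (.const eh) (.var 1)) (R (.const eo) (.var 1))
    (d.ite (R (.const eq) (.var 1))
      (.var 0 ⬝ .var 0 ⬝ R (R (.const er) (.var 1)) (.const φ ⬝ R (.const eo) (.var 1)))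
      (.var 0 ⬝ .var 0 ⬝ R (.const en) (.var 1)))
  let W : ℕ := d.clo d.env₀ (some 0) (d.lam 1 body)
  let E : ℕ := d.clo (upd d.env₀ (some 0) W) (some 1) body
  have key (j : ℕ) (s : State) (y : ℕ) (hy : (y, []) ∈ steps f s j) :
      n.ap (Part.some E) (Part.some (Encodable.encode s)) = Part.some y := by
    induction j generalizing s with
    | zero =>
      cases Part.mem_some_iff.1 hy
      refine d.clo_app_of ((Combinators.approx_ite_tt d ?_).of_eq_some ?_)
      · simpa [R, size] using heh (y, [])
      · simpa [R] using heo (y, [])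
    | succ j ih =>
      by_cases hs : size s = 0
      · obtain ⟨v, k⟩ := s
        obtain rfl : k = [] := List.length_eq_zero_iff.1 hs
        refine ih _ ?_
        rwa [steps_nil] at hy ⊢
      rw [steps_succ'] at hy
      obtain ⟨s', hs', hy⟩ := Part.mem_bind_iff.1 hy
      have hy := ih s' hy
      have hh := heh s
      have hq := heq s
      rw [if_neg hs] at hh
      refine d.clo_app_of ((Combinators.approx_ite_ff d (by simpa [R] using hh)).of_eq_some ?_)
      rw [step] at hs'
      split_ifs at hs' hq with h
      · obtain ⟨x, hx, rfl⟩ := (Part.mem_map_iff _).1 hs'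
        have h3 : n.ap (Part.some φ) (Part.some s.1) = Part.some x := by
          rw [n.ap_some_some]
          exact Part.eq_some_iff.2 (hφ _ _ hx)
        have h4 := her (Encodable.encode s) x
        rw [Denumerable.ofNat_encode] at h4
        refine (Combinators.approx_ite_tt d (by simpa [R] using hq)).of_eq_some ?_
        simpa [R, heo, h3, h4, W] using hy
      · rw [Part.mem_some_iff] at hs'
        subst hs'
        refine (Combinators.approx_ite_ff d (by simpa [R] using hq)).of_eq_some ?_
        simpa [R, hen, W] using hy
  refine ⟨d.clo d.env₀ (some 2) (d.lam 3 (.const E ⬝ R (R (.const ei) (.var 2)) (.var 3))),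
    fun a b x hx => ?_⟩
  obtain ⟨j, hj⟩ := reaches_iff (d := 0) |>.2 hx
  rw [← n.ap_some_some, d.clo_abs_app]
  refine Part.eq_some_iff.1 (d.clo_app_of ?_)
  have h3 := hei a b
  simpa [R, h3] using key j _ x hj

theorem kleeneOracle_isomorphic (f : ℕ →. ℕ) (c : Combinators kleene) :
    Isomorphic (kleeneOracle f) (c.adjoin f) := by
  obtain ⟨d⟩ := c.adjoin_isWeakPCA f
  obtain ⟨d'⟩ := (kleeneOracle_isPCA f).isWeakPCA
  refine .of_le (kleeneOracle_le d (c.le_adjoin f) (c.representable_adjoin f))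
    (c.adjoin_le d' (kleene_le_kleeneOracle f) (representable_iff.2 ⟨oracle.encode, ?_⟩))
  intro a x hx
  rwa [kleeneOracle_encode]

end VO

theorem corollary1p2 :
    -- (0) `A[f]` is again a weak pca, and it is isomorphic to a pca
    (∀ (A : Type u) (m : VO.PartialApp A) (c : VO.Combinators m) (f : A →. A),
      VO.IsWeakPCA (c.adjoin f) ∧
      ∃ n : VO.PartialApp A, VO.IsPCA n ∧ VO.Isomorphic (c.adjoin f) n) ∧
    -- (i) if `f` is representable in `A`, then `A ≅ A[f]`
    (∀ (A : Type u) (m : VO.PartialApp A) (c : VO.Combinators m) (f : A →. A),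
      VO.Representable m f → VO.Isomorphic m (c.adjoin f)) ∧
    -- (ii) `A[f][g] ≅ A[g][f]`
    (∀ (A : Type u) (m : VO.PartialApp A) (c : VO.Combinators m) (f g : A →. A)
      (cf : VO.Combinators (c.adjoin f)) (cg : VO.Combinators (c.adjoin g)),
      VO.Isomorphic (cf.adjoin g) (cg.adjoin f)) ∧
    -- (iii) `𝒦₁ᶠ ≅ 𝒦₁[f]`, and these are pcas
    (VO.IsPCA VO.kleene ∧
      ∀ (f : ℕ →. ℕ), VO.IsPCA (VO.kleeneOracle f) ∧
        ∀ c : VO.Combinators VO.kleene,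
          VO.IsPCA (c.adjoin f) ∧ VO.Isomorphic (VO.kleeneOracle f) (c.adjoin f)) ∧
    -- (iv) `A[f]` is never total (for `A` with more than one element), and some nontotal pca is
    -- isomorphic to a total pca
    ((∀ (A : Type u) [Nontrivial A] (m : VO.PartialApp A) (c : VO.Combinators m) (f : A →. A),
        ¬ VO.IsTotal (c.adjoin f)) ∧
      ∃ (A B : Type) (m : VO.PartialApp A) (n : VO.PartialApp B),
        VO.IsPCA m ∧ VO.IsPCA n ∧ ¬ VO.IsTotal m ∧ VO.IsTotal n ∧ VO.Isomorphic m n) := by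

  refine ⟨fun A m c f => ?_, fun A m c f hf => c.isomorphic_adjoin hf, fun A m c f g cf cg => ?_,
    ⟨VO.kleene_isPCA, fun f => ⟨VO.kleeneOracle_isPCA f, fun c =>
      ⟨VO.adjoin_kleene_isPCA c f, VO.kleeneOracle_isomorphic f c⟩⟩⟩,
    fun A _ m c f => c.adjoin_not_isTotal f, VO.exists_isTotal_isomorphic⟩
  · have h := c.adjoin_isWeakPCA f
    exact ⟨h, h.some.isomorphic_isPCA⟩
  · exact .of_le (c.adjoin_adjoin_le cf cg) (c.adjoin_adjoin_le cg cf)
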